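/- Let $k\ge 1$ be an integer, let $\sigma\ge k+1$, $\beta_1,\beta_2>0$ and $C_0$ be real constants, and let $\Omega=(0,1)^2$. There is a constant $C>0$, depending only on $k,\sigma,\beta_1,\beta_2,C_0$, such that the following holds for every even integer $N\ge 4$, every $0<\varepsilon\le N^{-1}$ and every $u$ as described below. **Mesh.** For $\beta>0$ set $$x_i^{\beta}=\begin{cases}-\frac{\sigma\varepsilon}{\beta}\ln\bigl(1-2(1-\varepsilon)\tfrac iN\bigr), & 0\le i\le N/2,\\[2pt] 1-\bigl(1-x^{\beta}_{N/2}\bigr)\frac{2(N-i)}{N}, & N/2<i\le N,\end{cases}$$ and let $x_i=x_i^{\beta_1}$, $y_j=x_j^{\beta_2}$. Assume that $\varepsilon$ is so small that the transition points satisfy $x_{N/2}\le\frac12$ and $y_{N/2}\le\frac12$. Let $\mathcal T_N$ be the set of the rectangles $T=[x_{i-1},x_i]\times[y_{j-1},y_j]$, $1\le i,j\le N$. Write $h_x,h_y$ for the width and height of $T$, let $\partial T_x$ (respectively $\partial T_y$) be the union of the two edges of $T$ parallel to the $x$-axis (respectively $y$-axis), and let $\Omega_0=[x_{N/2-1},x_N]\times[y_{N/2-1},y_N]$.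 **Function.** Let $u\in H^{k+1}(\Omega)$ have a decomposition $u=S+E_1+E_2+E_{12}$ such that for all $0\le i+j\le k+1$ the (weak) derivatives exist and satisfy, almost everywhere in $\Omega$, $$|\partial_x^i\partial_y^jS|\le C_0,\quad |\partial_x^i\partial_y^jE_1|\le C_0\varepsilon^{-j}e^{-\beta_2y/\varepsilon},\quad |\partial_x^i\partial_y^jE_2|\le C_0\varepsilon^{-i}e^{-\beta_1x/\varepsilon},\quad |\partial_x^i\partial_y^jE_{12}|\le C_0\varepsilon^{-(i+j)}e^{-(\beta_1x+\beta_2y)/\varepsilon}.$$ **Projections and weights.** On each $T$ let $\mathcal Q_0$ be the $L^2(T)$-projection onto $\mathbb Q_k(T)$, the polynomials of degree at most $k$ in each variable, and let $\mathbf Q_N$ be the $L^2(T)$-projection onto $[\mathbb Q_k(T)]^2$. Norms on edges are $L^2$ norms of traces from $T$. Let $$\theta_T=\begin{cases}\varepsilon^2N^{-1}, & T\subset\Omega_0,\\ \varepsilon h_y, & T\not\subset\Omega_0,\ \text{on }\partial T_x,\\ \varepsilon h_x, & T\not\subset\Omega_0,\ \text{on }\partial T_y,\end{cases}\qquad \vartheta_T=\begin{cases}N,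 & T\subset\Omega_0,\\ \varepsilon h_y^{-1}, & T\not\subset\Omega_0,\ \text{on }\partial T_x,\\ \varepsilon h_x^{-1}, & T\not\subset\Omega_0,\ \text{on }\partial T_y.\end{cases}$$ **Conclusion.** $$\Bigl(\sum_{T\in\mathcal T_N}\|u-\mathcal Q_0u\|_T^2\Bigr)^{1/2}\le CN^{-(k+1)},$$ $$\sum_{i=x,y}\Bigl(\sum_{T\in\mathcal T_N}\|u-\mathcal Q_0u\|_{\partial T_i}^2\Bigr)^{1/2}\le CN^{-(k+1/2)},$$ $$\sum_{i=x,y}\Bigl(\sum_{T\in\mathcal T_N}\theta_T\|\nabla u-\mathbf Q_N\nabla u\|_{\partial T_i}^2\Bigr)^{1/2}\le CN^{-k},$$ $$\sum_{i=x,y}\Bigl(\sum_{T\in\mathcal T_N}\vartheta_T\|u-\mathcal Q_0u\|_{\partial T_i}^2\Bigr)^{1/2}\le CN^{-k}.$$ -/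

import Mathlib

open MeasureTheory Set Filter Topology
open scoped ENNReal ContDiff

namespace LayerMesh

noncomputable section

/-! ### Sobolev functions on the unit square -/

/-- The domain `Ω = (0,1)²`. -/
def unitSquare : Set (ℝ × ℝ) := Ioo 0 1 ×ˢ Ioo 0 1

/-- The classical mixed derivative `∂ₓⁱ ∂ᵧʲ φ` (used for smooth `φ`). -/
def mixedDeriv (i j : ℕ) (φ : ℝ × ℝ → ℝ) (z : ℝ × ℝ) : ℝ :=
  iteratedDeriv i (fun x => iteratedDeriv j (fun y => φ (x, y)) z.2) z.1

/-- `w` is the weak derivative `∂ₓⁱ ∂ᵧʲ v` on `Ω`. -/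
def IsWeakDeriv (i j : ℕ) (v w : ℝ × ℝ → ℝ) : Prop :=
  LocallyIntegrableOn v unitSquare ∧ LocallyIntegrableOn w unitSquare ∧
    ∀ φ : ℝ × ℝ → ℝ, ContDiff ℝ ∞ φ → HasCompactSupport φ → tsupport φ ⊆ unitSquare →
      ∫ z in unitSquare, v z * mixedDeriv i j φ z
        = (-1 : ℝ) ^ (i + j) * ∫ z in unitSquare, w z * φ z

open Classical in
/-- The weak derivative `∂ₓⁱ ∂ᵧʲ v` on `Ω` (unique up to null sets; `0` if there is none). -/
def weakDeriv (i j : ℕ) (v : ℝ × ℝ → ℝ) : ℝ × ℝ → ℝ :=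
  if h : ∃ w, IsWeakDeriv i j v w then h.choose else 0

/-- `v ∈ Hᵐ(Ω)`: all weak derivatives of order at most `m` exist and lie in `L²(Ω)`. -/
def MemH (m : ℕ) (v : ℝ × ℝ → ℝ) : Prop :=
  ∀ i j : ℕ, i + j ≤ m →
    ∃ w, IsWeakDeriv i j v w ∧ MemLp w 2 (volume.restrict unitSquare)

/-- All derivatives `∂ₓⁱ ∂ᵧʲ v` with `i + j ≤ m` exist on `Ω` and satisfy
`|∂ₓⁱ ∂ᵧʲ v| ≤ C · W i j` almost everywhere on `Ω`. -/
def HasDerivBounds (m : ℕ) (C : ℝ) (W : ℕ → ℕ → ℝ × ℝ → ℝ) (v : ℝ × ℝ → ℝ) : Prop :=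
  ∀ i j : ℕ, i + j ≤ m →
    ∃ w, IsWeakDeriv i j v w ∧ ∀ᵐ z ∂volume.restrict unitSquare, |w z| ≤ C * W i j z

/-- The decomposition `u = S + E₁ + E₂ + E₁₂` into a smooth part, two boundary layers and a corner
layer, with derivative bounds up to order `k + 1` and constant `C`. -/
def HasLayerDecomposition (k : ℕ) (ε β₁ β₂ C : ℝ) (u : ℝ × ℝ → ℝ) : Prop :=
  ∃ S E₁ E₂ E₁₂ : ℝ × ℝ → ℝ,
    (∀ᵐ z ∂volume.restrict unitSquare, u z = S z + E₁ z + E₂ z + E₁₂ z) ∧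
    HasDerivBounds (k + 1) C (fun _ _ _ => 1) S ∧
    HasDerivBounds (k + 1) C (fun _ j z => (ε ^ j)⁻¹ * Real.exp (-(β₂ * z.2 / ε))) E₁ ∧
    HasDerivBounds (k + 1) C (fun i _ z => (ε ^ i)⁻¹ * Real.exp (-(β₁ * z.1 / ε))) E₂ ∧
    HasDerivBounds (k + 1) C
      (fun i j z => (ε ^ (i + j))⁻¹ * Real.exp (-((β₁ * z.1 + β₂ * z.2) / ε))) E₁₂

/-! ### Rectangles, norms and the local `L²` projection -/

/-- The data of a rectangle `[a,b] × [c,d]`. -/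
structure Rect where
  a : ℝ
  b : ℝ
  c : ℝ
  d : ℝ

/-- The closed rectangle `[a,b] × [c,d]`. -/
def Rect.toSet (T : Rect) : Set (ℝ × ℝ) := Icc T.a T.b ×ˢ Icc T.c T.d

/-- The width `h_x`. -/
def Rect.hx (T : Rect) : ℝ := T.b - T.a

/-- The height `h_y`. -/
def Rect.hy (T : Rect) : ℝ := T.d - T.c

/-- The polynomials in `(x, y)` of degree at most `k` in each variable. -/
def polyQ (k : ℕ) : Submodule ℝ (ℝ × ℝ → ℝ) :=
  Submodule.span ℝ (range fun p : Fin (k + 1) × Fin (k + 1) =>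
    fun z : ℝ × ℝ => z.1 ^ (p.1 : ℕ) * z.2 ^ (p.2 : ℕ))

/-- `q` is the `L²(T)`-orthogonal projection of `v` onto the polynomials `polyQ k`. -/
def IsL2Proj (k : ℕ) (T : Rect) (v q : ℝ × ℝ → ℝ) : Prop :=
  q ∈ polyQ k ∧ ∀ p ∈ polyQ k, ∫ z in T.toSet, (v z - q z) * p z = 0

open Classical in
/-- The `L²(T)`-orthogonal projection of `v` onto `polyQ k`; see `existsUnique_isL2Proj`. -/
def l2Proj (k : ℕ) (T : Rect) (v : ℝ × ℝ → ℝ) : ℝ × ℝ → ℝ :=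
  if h : ∃ q, IsL2Proj k T v q then h.choose else 0

theorem polyQ_analytic {k : ℕ} {q : ℝ × ℝ → ℝ} (hq : q ∈ polyQ k) :
    AnalyticOnNhd ℝ q univ := by
  induction hq using Submodule.span_induction with
  | mem f hf =>
    obtain ⟨p, rfl⟩ := hf
    exact (analyticOnNhd_fst.pow _).mul (analyticOnNhd_snd.pow _)
  | zero => exact analyticOnNhd_const
  | add f g _ _ hf hg => exact hf.add hg
  | smul c f _ hf => exact (analyticOnNhd_const (v := c)).mul hf

theorem polyQ_continuous {k : ℕ} {q : ℝ × ℝ → ℝ} (hq : q ∈ polyQ k) : Continuous q :=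
  continuousOn_univ.1 (polyQ_analytic hq).continuousOn

theorem Rect.isCompact_toSet (T : Rect) : IsCompact T.toSet :=
  isCompact_Icc.prod isCompact_Icc

theorem polyQ_integrableOn_mul {k : ℕ} {T : Rect} {v q : ℝ × ℝ → ℝ}
    (hv : IntegrableOn v T.toSet) (hq : q ∈ polyQ k) :
    IntegrableOn (fun z => v z * q z) T.toSet :=
  hv.mul_continuousOn (polyQ_continuous hq).continuousOn T.isCompact_toSet

theorem polyQ_integrableOn {k : ℕ} {T : Rect} {q : ℝ × ℝ → ℝ} (hq : q ∈ polyQ k) :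
    IntegrableOn q T.toSet :=
  (polyQ_continuous hq).continuousOn.integrableOn_compact T.isCompact_toSet

theorem polyQ_eq_zero {k : ℕ} {T : Rect} (hx : T.a < T.b) (hy : T.c < T.d) {q : ℝ × ℝ → ℝ}
    (hq : q ∈ polyQ k) (h : ∫ z in T.toSet, q z * q z = 0) : q = 0 := by
  have h0 : (fun z => q z * q z) =ᵐ[volume.restrict T.toSet] 0 :=
    (integral_eq_zero_iff_of_nonneg (fun z => mul_self_nonneg _)
      (polyQ_integrableOn_mul (polyQ_integrableOn hq) hq)).1 h
  have hsub : Ioo T.a T.b ×ˢ Ioo T.c T.d ⊆ T.toSet :=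
    prod_mono Ioo_subset_Icc_self Ioo_subset_Icc_self
  have hop : IsOpen (Ioo T.a T.b ×ˢ Ioo T.c T.d) := isOpen_Ioo.prod isOpen_Ioo
  have h1 : q =ᵐ[volume.restrict (Ioo T.a T.b ×ˢ Ioo T.c T.d)] 0 := by
    filter_upwards [ae_restrict_of_ae_restrict_of_subset hsub h0] with z hz
    exact mul_self_eq_zero.1 hz
  have h2 : EqOn q 0 (Ioo T.a T.b ×ˢ Ioo T.c T.d) :=
    Measure.eqOn_open_of_ae_eq h1 hop (polyQ_continuous hq).continuousOn continuousOn_const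
  have hmem : ((T.a + T.b) / 2, (T.c + T.d) / 2) ∈ Ioo T.a T.b ×ˢ Ioo T.c T.d :=
    ⟨⟨by dsimp only; linarith, by dsimp only; linarith⟩,
      ⟨by dsimp only; linarith, by dsimp only; linarith⟩⟩
  have h3 := (polyQ_analytic hq).eqOn_zero_of_preconnected_of_eventuallyEq_zero
    isPreconnected_univ (mem_univ _) (h2.eventuallyEq_of_mem (hop.mem_nhds hmem))
  funext z
  exact h3 (mem_univ z)

/-- On a nondegenerate rectangle the projection exists and is unique. -/
theorem existsUnique_isL2Proj (k : ℕ) {T : Rect} (hx : T.a < T.b) (hy : T.c < T.d)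
    {v : ℝ × ℝ → ℝ} (hv : IntegrableOn v T.toSet) : ∃! q, IsL2Proj k T v q := by
  have : FiniteDimensional ℝ (polyQ k) :=
    FiniteDimensional.span_of_finite ℝ (finite_range _)
  let L : (w : ℝ × ℝ → ℝ) → IntegrableOn w T.toSet → (polyQ k →ₗ[ℝ] ℝ) := fun w hw =>
    { toFun := fun p => ∫ z in T.toSet, w z * (p : ℝ × ℝ → ℝ) z
      map_add' := fun p p' => by
        rw [← integral_add (polyQ_integrableOn_mul hw p.2) (polyQ_integrableOn_mul hw p'.2)]
        simp [mul_add]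
      map_smul' := fun c p => by
        rw [RingHom.id_apply, smul_eq_mul, ← integral_const_mul]
        simp [mul_left_comm] }
  let A : polyQ k →ₗ[ℝ] Module.Dual ℝ (polyQ k) :=
    { toFun := fun q => L q (polyQ_integrableOn q.2)
      map_add' := fun q q' => by
        ext p
        change ∫ z in T.toSet, ((q : ℝ × ℝ → ℝ) z + (q' : ℝ × ℝ → ℝ) z) * (p : ℝ × ℝ → ℝ) z
          = (∫ z in T.toSet, (q : ℝ × ℝ → ℝ) z * (p : ℝ × ℝ → ℝ) z)
            + ∫ z in T.toSet, (q' : ℝ × ℝ → ℝ) z * (p : ℝ × ℝ → ℝ) z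
        rw [← integral_add (polyQ_integrableOn_mul (polyQ_integrableOn q.2) p.2)
          (polyQ_integrableOn_mul (polyQ_integrableOn q'.2) p.2)]
        simp [add_mul]
      map_smul' := fun c q => by
        ext p
        change ∫ z in T.toSet, (c * (q : ℝ × ℝ → ℝ) z) * (p : ℝ × ℝ → ℝ) z
          = c * ∫ z in T.toSet, (q : ℝ × ℝ → ℝ) z * (p : ℝ × ℝ → ℝ) z
        rw [← integral_const_mul]
        simp [mul_assoc] }
  have hinj : Function.Injective A := by
    rw [injective_iff_map_eq_zero]
    intro q hq
    exact Subtype.ext (polyQ_eq_zero hx hy q.2 (LinearMap.congr_fun hq q))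
  have hsurj : Function.Surjective A :=
    (LinearMap.injective_iff_surjective_of_finrank_eq_finrank
      Subspace.dual_finrank_eq.symm).1 hinj
  obtain ⟨q, hq⟩ := hsurj (L v hv)
  refine ⟨q, ⟨q.2, fun p hp => ?_⟩, fun q' hq' => ?_⟩
  · have h : ∫ z in T.toSet, (q : ℝ × ℝ → ℝ) z * p z = ∫ z in T.toSet, v z * p z :=
      LinearMap.congr_fun hq ⟨p, hp⟩
    simp only [sub_mul]
    rw [integral_sub (polyQ_integrableOn_mul hv hp)
      (polyQ_integrableOn_mul (polyQ_integrableOn q.2) hp), h, sub_self]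
  · have h : A ⟨q', hq'.1⟩ = A q := by
      rw [hq]
      ext p
      have := hq'.2 p p.2
      simp only [sub_mul] at this
      rw [integral_sub (polyQ_integrableOn_mul hv p.2)
        (polyQ_integrableOn_mul (polyQ_integrableOn hq'.1) p.2), sub_eq_zero] at this
      exact this.symm
    exact congrArg Subtype.val (hinj h)

/-- The trace on `∂T` of a Sobolev function `v` on `T`: the limit of the mean values of `v` over
`B(z,r) ∩ T` as `r → 0⁺`. For `v ∈ H¹(T)` it agrees with the usual trace at almost every point of
`∂T`, and if `v` has a representative that is continuous on `T` it is the value of that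
representative. -/
def trace (T : Rect) (v : ℝ × ℝ → ℝ) (z : ℝ × ℝ) : ℝ :=
  limUnder (𝓝[>] (0 : ℝ)) fun r => ⨍ w in Metric.ball z r ∩ T.toSet, v w

/-- `‖v‖²_T`, the squared norm of `L²(T)`. -/
def normSq (T : Rect) (v : ℝ × ℝ → ℝ) : ℝ≥0∞ :=
  ∫⁻ z in T.toSet, ‖v z‖ₑ ^ 2

/-- `‖v‖²_{∂T_x}`, where `∂T_x` consists of the two edges of `T` parallel to the `x`-axis. -/
def edgeNormSqX (T : Rect) (v : ℝ × ℝ → ℝ) : ℝ≥0∞ :=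
  (∫⁻ x in Icc T.a T.b, ‖trace T v (x, T.c)‖ₑ ^ 2)
    + ∫⁻ x in Icc T.a T.b, ‖trace T v (x, T.d)‖ₑ ^ 2

/-- `‖v‖²_{∂T_y}`, where `∂T_y` consists of the two edges of `T` parallel to the `y`-axis. -/
def edgeNormSqY (T : Rect) (v : ℝ × ℝ → ℝ) : ℝ≥0∞ :=
  (∫⁻ y in Icc T.c T.d, ‖trace T v (T.a, y)‖ₑ ^ 2)
    + ∫⁻ y in Icc T.c T.d, ‖trace T v (T.b, y)‖ₑ ^ 2

/-! ### The Bakhvalov-type mesh -/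

/-- The logarithmically graded points `-(σ ε / β) ln (1 - 2 (1 - ε) i / N)`. -/
def layerPoint (σ ε β : ℝ) (N i : ℕ) : ℝ :=
  -(σ * ε / β) * Real.log (1 - 2 * (1 - ε) * i / N)

/-- The one-dimensional Bakhvalov-type mesh points for a layer of decay rate `β` (with `N` even):
graded for `i ≤ N/2` and equidistant for `i ≥ N/2`. -/
def meshPoint (σ ε β : ℝ) (N i : ℕ) : ℝ :=
  if i ≤ N / 2 then layerPoint σ ε β N i
  else 1 - (1 - layerPoint σ ε β N (N / 2)) * (2 * ((N : ℝ) - i) / N)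

/-- The mesh rectangle `[x_i, x_{i+1}] × [y_j, y_{j+1}]`, for `0 ≤ i, j < N`. -/
def meshElem (σ ε β₁ β₂ : ℝ) (N i j : ℕ) : Rect where
  a := meshPoint σ ε β₁ N i
  b := meshPoint σ ε β₁ N (i + 1)
  c := meshPoint σ ε β₂ N j
  d := meshPoint σ ε β₂ N (j + 1)

/-- `[x_i, x_{i+1}] × [y_j, y_{j+1}]` lies in
`Ω₀ = [x_{N/2-1}, x_N] × [y_{N/2-1}, y_N]`. -/
abbrev InOmega0 (N i j : ℕ) : Prop := N / 2 ≤ i + 1 ∧ N / 2 ≤ j + 1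

/-- The weight `θ_T` on an edge, `h` being the width of `T` orthogonal to that edge. -/
def theta (ε : ℝ) (N i j : ℕ) (h : ℝ) : ℝ :=
  if InOmega0 N i j then ε ^ 2 * (N : ℝ)⁻¹ else ε * h

/-- The weight `ϑ_T` on an edge, `h` being the width of `T` orthogonal to that edge. -/
def vartheta (ε : ℝ) (N i j : ℕ) (h : ℝ) : ℝ :=
  if InOmega0 N i j then (N : ℝ) else ε * h⁻¹

/-- The global quantity `(∑_T a_T)^{1/2}`, the sum running over all elements of the mesh. -/
def meshNorm (N : ℕ) (a : ℕ → ℕ → ℝ≥0∞) : ℝ≥0∞ :=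
  (∑ i ∈ Finset.range N, ∑ j ∈ Finset.range N, a i j) ^ (1 / 2 : ℝ)

/-- The local error `v - 𝒬₀ v` on the element `T`. -/
def projErr (k : ℕ) (T : Rect) (v : ℝ × ℝ → ℝ) (z : ℝ × ℝ) : ℝ :=
  v z - l2Proj k T v z

end

end LayerMesh

open LayerMesh

namespace LayerMesh

/-! ### Polynomials on rectangles -/

/-! Everything follows from maximum norm bounds on single cells, uniform enough that each sum over
the mesh may be replaced by `N ^ 2` times a bound for its largest term (`meshNorm_le`). These bounds
(`exists_cell_bounds`) are `N⁻¹ ^ (k + 1)` for the error of `u` and `N⁻¹ ^ k * (ε⁻¹ * (τx + τy))`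
for that of its first derivatives, up to constants, where `τx` and `τy` measure how far the layers
have decayed on the cell.

The mesh fits the layers as follows. With `t = layerArg ε N i`, the layer function at the `i`-th
graded point is `t ^ σ ≤ t ^ (k + 1)`, because `σ ≥ k + 1`, and away from the transition point the
interval starting there has width at most of order `ε / (N * t)`. A derivative of a layer costs a
factor `ε⁻¹` and a power of the width gains `ε / (N * t)`, so a Taylor remainder of order `m` has
size `N⁻¹ ^ m * t ^ (k + 1 - m)`, times `ε⁻¹` per derivative already taken. Taking `m = k + 1`
treats `u`, and `m = k` its gradient. On the last graded interval and on the equidistant part the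
layer is itself of size `N⁻¹ ^ (k + 1)`; there `τ = N⁻¹` and zero is a good enough approximant
(`exists_meshInterval`, `approxOn_component`).

Three analytic facts turn this into error bounds. Mollification carries the anisotropic Taylor
formula over to weak derivatives (`approxOn_of_isWeakJet`). The `L²` projection is quasi-optimal in
the maximum norm, uniformly in the aspect ratio of the cell, by an inverse estimate
(`exists_projErr_bound`). Derivatives of order at most `k` have Lipschitz representatives, so traces
inherit almost everywhere bounds (`exists_continuous_ae_eq`, `abs_trace_le`).

For the weighted gradient norm, the factor `ε⁻²` meets a weight of order `ε ^ 2` in `Ω₀`; elsewhere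
it meets `ε` times the cell area, and the area times `(τx + τy) ^ 2` is of order `ε * N⁻¹ ^ 2`
(`area_mul_sq_le`). -/

theorem monomial_mem_polyQ {k i j : ℕ} (hi : i ≤ k) (hj : j ≤ k) :
    (fun z : ℝ × ℝ => z.1 ^ i * z.2 ^ j) ∈ polyQ k :=
  Submodule.subset_span ⟨(⟨i, by omega⟩, ⟨j, by omega⟩), rfl⟩

theorem affine_monomial_mem_polyQ {k i j : ℕ} (hi : i ≤ k) (hj : j ≤ k) (a b c d : ℝ) :
    (fun z : ℝ × ℝ => (a * z.1 + b) ^ i * (c * z.2 + d) ^ j) ∈ polyQ k := by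
  have h : (fun z : ℝ × ℝ => (a * z.1 + b) ^ i * (c * z.2 + d) ^ j)
      = ∑ s ∈ Finset.range (i + 1), ∑ t ∈ Finset.range (j + 1),
        (a ^ s * b ^ (i - s) * (i.choose s) * (c ^ t * d ^ (j - t) * (j.choose t))) •
          fun z : ℝ × ℝ => z.1 ^ s * z.2 ^ t := by
    funext z
    simp only [Finset.sum_apply, Pi.smul_apply, smul_eq_mul]
    rw [add_pow, add_pow, Finset.sum_mul_sum]
    refine Finset.sum_congr rfl fun s _ => Finset.sum_congr rfl fun t _ => ?_
    rw [mul_pow, mul_pow]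
    ring
  rw [h]
  refine Submodule.sum_mem _ fun s hs => Submodule.sum_mem _ fun t ht =>
    Submodule.smul_mem _ _ (monomial_mem_polyQ ?_ ?_)
  · have := Finset.mem_range.1 hs; omega
  · have := Finset.mem_range.1 ht; omega

theorem polyQ_comp_affine {k : ℕ} {q : ℝ × ℝ → ℝ} (hq : q ∈ polyQ k) (a b c d : ℝ) :
    (fun z : ℝ × ℝ => q (a * z.1 + b, c * z.2 + d)) ∈ polyQ k := by
  induction hq using Submodule.span_induction with
  | mem f hf =>
    obtain ⟨p, rfl⟩ := hf
    exact affine_monomial_mem_polyQ (by omega) (by omega) a b c d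
  | zero => exact Submodule.zero_mem _
  | add f g _ _ hf hg => exact Submodule.add_mem _ hf hg
  | smul r f _ hf => exact Submodule.smul_mem _ r hf

/-- The reference square `[0,1]²`. -/
def refRect : Rect := ⟨0, 1, 0, 1⟩

/-- The `L²` inner product on `polyQ k` over the reference square. -/
noncomputable abbrev polyQCore (k : ℕ) : InnerProductSpace.Core ℝ (polyQ k) where
  inner p q := ∫ z in refRect.toSet, (p : ℝ × ℝ → ℝ) z * (q : ℝ × ℝ → ℝ) z
  conj_inner_symm p q := by simp [mul_comm]
  re_inner_nonneg p := by
    simpa using integral_nonneg fun z => mul_self_nonneg ((p : ℝ × ℝ → ℝ) z)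
  add_left p q r := by
    rw [← integral_add (polyQ_integrableOn_mul (polyQ_integrableOn p.2) r.2)
      (polyQ_integrableOn_mul (polyQ_integrableOn q.2) r.2)]
    simp [add_mul]
  smul_left p q c := by
    simp only [conj_trivial]
    rw [← integral_const_mul]
    simp [mul_assoc]
  definite p h := Subtype.ext (polyQ_eq_zero (T := refRect) zero_lt_one zero_lt_one p.2 h)

/-- To be used for the inclusion of `polyQ k`, normed by `polyQCore`, into the continuous functions
on the reference square. -/
theorem exists_norm_le_of_finiteDimensional {V F : Type*} [NormedAddCommGroup V] [NormedSpace ℝ V]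
    [FiniteDimensional ℝ V] [NormedAddCommGroup F] [NormedSpace ℝ F] (L : V →ₗ[ℝ] F) :
    ∃ C : ℝ, ∀ v, ‖L v‖ ≤ C * ‖v‖ :=
  ⟨‖L.toContinuousLinearMap‖, L.toContinuousLinearMap.le_opNorm⟩

theorem exists_refRect_sup_bound (k : ℕ) : ∃ C : ℝ, 0 < C ∧ ∀ q ∈ polyQ k, ∀ z ∈ refRect.toSet,
    q z ^ 2 ≤ C * ∫ w in refRect.toSet, q w * q w := by
  have hfd : FiniteDimensional ℝ (polyQ k) := FiniteDimensional.span_of_finite ℝ (finite_range _)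
  let core := polyQCore k
  let i1 : NormedAddCommGroup (polyQ k) := core.toNormedAddCommGroup
  let i2 : InnerProductSpace ℝ (polyQ k) := InnerProductSpace.ofCore core.toCore
  have : CompactSpace refRect.toSet := isCompact_iff_compactSpace.1 refRect.isCompact_toSet
  let L : polyQ k →ₗ[ℝ] C(refRect.toSet, ℝ) :=
    { toFun := fun p =>
        ⟨fun z => (p : ℝ × ℝ → ℝ) z, (polyQ_continuous p.2).comp continuous_subtype_val⟩
      map_add' := fun p q => rfl
      map_smul' := fun c p => rfl }
  obtain ⟨C, hC⟩ := exists_norm_le_of_finiteDimensional L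
  -- The square comes from squaring the norm inequality; the `1` makes the constant positive.
  refine ⟨C ^ 2 + 1, by positivity, fun q hq z hz => ?_⟩
  have h1 : |q z| ≤ C * ‖(⟨q, hq⟩ : polyQ k)‖ :=
    ((L ⟨q, hq⟩).norm_coe_le_norm ⟨z, hz⟩).trans (hC ⟨q, hq⟩)
  have h2 : ‖(⟨q, hq⟩ : polyQ k)‖ ^ 2 = ∫ w in refRect.toSet, q w * q w := by
    rw [← real_inner_self_eq_norm_sq]; rfl
  have h3 : 0 ≤ ∫ w in refRect.toSet, q w * q w := integral_nonneg fun z => mul_self_nonneg _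
  have h4 := pow_le_pow_left₀ (abs_nonneg _) h1 2
  rw [sq_abs, mul_pow, h2] at h4
  linarith

theorem integral_rect_eq {T : Rect} (hx : T.a < T.b) (hy : T.c < T.d) {f : ℝ × ℝ → ℝ}
    (hf : Continuous f) :
    ∫ z in T.toSet, f z
      = T.hx * T.hy * ∫ z in refRect.toSet, f (T.hx * z.1 + T.a, T.hy * z.2 + T.c) := by
  have hx' : T.hx ≠ 0 := (sub_pos.2 hx).ne'
  have hy' : T.hy ≠ 0 := (sub_pos.2 hy).ne'
  have key : ∀ (R : Rect), R.a ≤ R.b → R.c ≤ R.d → ∀ g : ℝ × ℝ → ℝ, Continuous g →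
      ∫ z in R.toSet, g z = ∫ x in R.a..R.b, ∫ y in R.c..R.d, g (x, y) := by
    intro R h1 h2 g hg
    rw [Rect.toSet, Measure.volume_eq_prod, setIntegral_prod _
      (by rw [← Measure.volume_eq_prod]
          exact hg.continuousOn.integrableOn_compact (isCompact_Icc.prod isCompact_Icc)),
      integral_Icc_eq_integral_Ioc, intervalIntegral.integral_of_le h1]
    refine integral_congr_ae (Eventually.of_forall fun x => ?_)
    simp only
    rw [integral_Icc_eq_integral_Ioc, intervalIntegral.integral_of_le h2]
  rw [key T hx.le hy.le f hf, key refRect zero_le_one zero_le_one _ (by fun_prop)]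
  have e1 : ∀ x, ∫ y in refRect.c..refRect.d, f (T.hx * x + T.a, T.hy * y + T.c)
      = T.hy⁻¹ * ∫ y in T.c..T.d, f (T.hx * x + T.a, y) := by
    intro x
    rw [intervalIntegral.integral_comp_mul_add (fun y => f (T.hx * x + T.a, y)) hy']
    simp [refRect, Rect.hy]
  simp only [e1]
  rw [intervalIntegral.integral_const_mul,
    intervalIntegral.integral_comp_mul_add (fun x => ∫ y in T.c..T.d, f (x, y)) hx']
  simp only [refRect, mul_zero, zero_add, mul_one, smul_eq_mul]
  have : T.hx + T.a = T.b := by simp [Rect.hx]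
  rw [this]
  field_simp

/-- `polyQ k` is invariant under scaling each axis separately, and the area is the only trace that
scaling leaves. Hence the constant of the reference square serves every rectangle, however thin. -/
theorem exists_inverse_estimate (k : ℕ) : ∃ C : ℝ, 0 < C ∧ ∀ T : Rect, T.a < T.b → T.c < T.d →
    ∀ q ∈ polyQ k, ∀ z ∈ T.toSet, T.hx * T.hy * q z ^ 2 ≤ C * ∫ w in T.toSet, q w * q w := by
  obtain ⟨C, hC, h⟩ := exists_refRect_sup_bound k
  refine ⟨C, hC, fun T hx hy q hq z hz => ?_⟩
  have hx' : 0 < T.hx := sub_pos.2 hx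
  have hy' : 0 < T.hy := sub_pos.2 hy
  have hqc := polyQ_continuous hq
  rw [integral_rect_eq hx hy (f := fun w => q w * q w) (hqc.mul hqc)]
  have h1 := h _ (polyQ_comp_affine hq T.hx T.a T.hy T.c)
    ((z.1 - T.a) / T.hx, (z.2 - T.c) / T.hy)
    ⟨⟨div_nonneg (sub_nonneg.2 hz.1.1) hx'.le,
      (div_le_one hx').2 (by have := hz.1.2; simp only [Rect.hx]; linarith)⟩,
      ⟨div_nonneg (sub_nonneg.2 hz.2.1) hy'.le,
      (div_le_one hy').2 (by have := hz.2.2; simp only [Rect.hy]; linarith)⟩⟩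
  have e : ((T.hx * ((z.1 - T.a) / T.hx) + T.a, T.hy * ((z.2 - T.c) / T.hy) + T.c) : ℝ × ℝ) = z := by
    ext <;> simp [mul_div_cancel₀ _ hx'.ne', mul_div_cancel₀ _ hy'.ne']
  simp only [e] at h1
  calc T.hx * T.hy * q z ^ 2 ≤ T.hx * T.hy * _ := mul_le_mul_of_nonneg_left h1 (by positivity)
    _ = _ := by ring

theorem Rect.measureReal_toSet {T : Rect} (hx : T.a ≤ T.b) (hy : T.c ≤ T.d) :
    volume.real T.toSet = T.hx * T.hy := by
  rw [Rect.toSet, Measure.volume_eq_prod, measureReal_prod_prod]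
  simp [Rect.hx, Rect.hy, hx, hy]

theorem l2Proj_spec {k : ℕ} {T : Rect} (hx : T.a < T.b) (hy : T.c < T.d) {v : ℝ × ℝ → ℝ}
    (hv : IntegrableOn v T.toSet) : IsL2Proj k T v (l2Proj k T v) := by
  have h := (existsUnique_isL2Proj k hx hy hv).exists
  rw [l2Proj, dif_pos h]
  exact h.choose_spec

/-- Quasi-optimality of the `L²` projection in the maximum norm, uniformly in the rectangle. -/
theorem exists_projErr_bound (k : ℕ) : ∃ C : ℝ, 0 < C ∧ ∀ T : Rect, T.a < T.b → T.c < T.d →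
    ∀ (v p : ℝ × ℝ → ℝ) (B : ℝ), IntegrableOn v T.toSet → p ∈ polyQ k →
      (∀ᵐ z ∂volume.restrict T.toSet, |v z - p z| ≤ B) →
      ∀ᵐ z ∂volume.restrict T.toSet, |projErr k T v z| ≤ C * B := by
  obtain ⟨C, hC, h⟩ := exists_inverse_estimate k
  refine ⟨1 + C, by positivity, fun T hx hy v p B hv hp hB => ?_⟩
  obtain ⟨hq, hort⟩ := l2Proj_spec (k := k) hx hy hv
  set q := l2Proj k T v with hqdef
  have hx' : 0 < T.hx := sub_pos.2 hx
  have hy' : 0 < T.hy := sub_pos.2 hy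
  have hr : q - p ∈ polyQ k := Submodule.sub_mem _ hq hp
  have hrc := polyQ_continuous hr
  -- The error is split as `(v - p) - (q - p)`; only the maximum `s` of the polynomial `|q - p|` has
  -- to be bounded.
  obtain ⟨z₀, hz₀, hmax⟩ := T.isCompact_toSet.exists_isMaxOn
    ⟨(T.a, T.c), ⟨left_mem_Icc.2 hx.le, left_mem_Icc.2 hy.le⟩⟩ hrc.abs.continuousOn
  set s := |(q - p) z₀| with hs
  have hle : ∀ z ∈ T.toSet, |(q - p) z| ≤ s := fun z hz => hmax hz
  have hvp : IntegrableOn (fun z => v z - p z) T.toSet := hv.sub (polyQ_integrableOn hp)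
  -- Orthogonality of `v - q` to `q - p`.
  have e1 : ∫ z in T.toSet, (q - p) z * (q - p) z = ∫ z in T.toSet, (v z - p z) * (q - p) z := by
    have h0 := hort _ hr
    have : ∀ z, (v z - q z) * (q - p) z = (v z - p z) * (q - p) z - (q - p) z * (q - p) z := by
      intro z; simp only [Pi.sub_apply]; ring
    simp only [this] at h0
    rw [integral_sub (polyQ_integrableOn_mul hvp hr)
      (polyQ_integrableOn_mul (polyQ_integrableOn hr) hr), sub_eq_zero] at h0
    exact h0.symm
  have e2 : ∫ z in T.toSet, (v z - p z) * (q - p) z ≤ B * s * (T.hx * T.hy) := by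
    rw [← Rect.measureReal_toSet hx.le hy.le]
    refine (le_abs_self _).trans ?_
    rw [← Real.norm_eq_abs]
    refine norm_setIntegral_le_of_norm_le_const_ae' T.isCompact_toSet.measure_lt_top ?_
    have hm : MeasurableSet T.toSet := T.isCompact_toSet.measurableSet
    filter_upwards [(ae_restrict_iff' hm).1 hB] with z hz hzT
    rw [Real.norm_eq_abs, abs_mul]
    exact mul_le_mul (hz hzT) (hle z hzT) (abs_nonneg _) ((abs_nonneg _).trans (hz hzT))
  have h3 := h T hx hy _ hr z₀ hz₀
  rw [e1] at h3
  -- The inverse estimate at the maximum point. The area and one factor `s` cancel.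
  have h4 : T.hx * T.hy * s ^ 2 ≤ C * (B * s * (T.hx * T.hy)) := by
    rw [hs, sq_abs]; exact h3.trans (mul_le_mul_of_nonneg_left e2 hC.le)
  -- Needed when `s = 0`. A rectangle of positive measure contains a point where the almost
  -- everywhere bound holds.
  have hB0 : 0 ≤ B := by
    by_contra hneg
    have hne : (volume.restrict T.toSet) ≠ 0 := by
      intro h0
      have := Rect.measureReal_toSet hx.le hy.le
      rw [Measure.restrict_eq_zero] at h0
      rw [measureReal_def, h0] at this
      have hp : 0 < T.hx * T.hy := by positivity
      simp at this
      rcases this with h | h <;> linarith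
    have : (ae (volume.restrict T.toSet)).NeBot := ae_neBot.2 hne
    obtain ⟨z, hz⟩ := hB.exists
    linarith [abs_nonneg (v z - p z)]
  have h5 : s ≤ C * B := by
    have hs0 : 0 ≤ s := abs_nonneg _
    rcases hs0.eq_or_lt with h0 | h0
    · rw [← h0]; positivity
    · have hp : 0 < T.hx * T.hy * s := by positivity
      refine le_of_mul_le_mul_left ?_ hp
      calc T.hx * T.hy * s * s = T.hx * T.hy * s ^ 2 := by ring
        _ ≤ _ := h4
        _ = _ := by ring
  filter_upwards [hB, ae_restrict_mem T.isCompact_toSet.measurableSet] with z hz hzT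
  have h6 := (hle z hzT).trans h5
  simp only [Pi.sub_apply] at h6
  rw [projErr, ← hqdef]
  calc |v z - q z| = |(v z - p z) - (q z - p z)| := by congr 1; ring
    _ ≤ |v z - p z| + |q z - p z| := abs_sub _ _
    _ ≤ _ := by linarith

/-! ### Mixed partial derivatives of smooth functions -/

/-- The classical partial derivative `∂ₓ φ`. -/
noncomputable def partialX (φ : ℝ × ℝ → ℝ) (z : ℝ × ℝ) : ℝ := fderiv ℝ φ z (1, 0)

/-- The classical partial derivative `∂ᵧ φ`. -/
noncomputable def partialY (φ : ℝ × ℝ → ℝ) (z : ℝ × ℝ) : ℝ := fderiv ℝ φ z (0, 1)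

/-- The classical derivative `∂ₓⁱ ∂ᵧʲ φ`, as an iterated directional derivative. -/
noncomputable def partialXY (i j : ℕ) (φ : ℝ × ℝ → ℝ) : ℝ × ℝ → ℝ := partialX^[i] (partialY^[j] φ)

section Calculus

variable {φ ψ : ℝ × ℝ → ℝ}

theorem contDiff_partialX (h : ContDiff ℝ ∞ φ) : ContDiff ℝ ∞ (partialX φ) :=
  (h.fderiv_right (m := ∞) le_rfl).clm_apply contDiff_const

theorem contDiff_partialY (h : ContDiff ℝ ∞ φ) : ContDiff ℝ ∞ (partialY φ) :=
  (h.fderiv_right (m := ∞) le_rfl).clm_apply contDiff_const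

theorem contDiff_iterate_partialX (h : ContDiff ℝ ∞ φ) (i : ℕ) : ContDiff ℝ ∞ (partialX^[i] φ) := by
  induction i generalizing φ with
  | zero => exact h
  | succ i ih => exact ih (contDiff_partialX h)

theorem contDiff_iterate_partialY (h : ContDiff ℝ ∞ φ) (i : ℕ) : ContDiff ℝ ∞ (partialY^[i] φ) := by
  induction i generalizing φ with
  | zero => exact h
  | succ i ih => exact ih (contDiff_partialY h)

theorem contDiff_partialXY (h : ContDiff ℝ ∞ φ) (i j : ℕ) : ContDiff ℝ ∞ (partialXY i j φ) :=
  contDiff_iterate_partialX (contDiff_iterate_partialY h j) i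

theorem smooth_differentiable (h : ContDiff ℝ ∞ φ) : Differentiable ℝ φ :=
  h.differentiable (by simp)

theorem partialX_partialY_comm (h : ContDiff ℝ ∞ φ) :
    partialX (partialY φ) = partialY (partialX φ) := by
  funext z
  have hd : DifferentiableAt ℝ (fderiv ℝ φ) z :=
    ((h.fderiv_right (m := ∞) le_rfl).differentiable (by simp)) z
  have hs : IsSymmSndFDerivAt ℝ φ z := h.contDiffAt.isSymmSndFDerivAt (by
    rw [minSmoothness_of_isRCLikeNormedField]; exact WithTop.coe_le_coe.2 le_top)
  have e : ∀ a b : ℝ × ℝ, fderiv ℝ (fun w => fderiv ℝ φ w a) z b = fderiv ℝ (fderiv ℝ φ) z b a := by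
    intro a b
    rw [fderiv_clm_apply hd (differentiableAt_const a)]
    simp
  change fderiv ℝ (fun w => fderiv ℝ φ w (0, 1)) z (1, 0)
    = fderiv ℝ (fun w => fderiv ℝ φ w (1, 0)) z (0, 1)
  rw [e, e]
  exact hs _ _

theorem partialX_iterate_partialY_comm (h : ContDiff ℝ ∞ φ) (j : ℕ) :
    partialX (partialY^[j] φ) = partialY^[j] (partialX φ) := by
  induction j generalizing φ with
  | zero => rfl
  | succ j ih =>
    rw [Function.iterate_succ_apply, Function.iterate_succ_apply, ih (contDiff_partialY h),
      partialX_partialY_comm h]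

theorem partialXY_partialX (h : ContDiff ℝ ∞ φ) (i j : ℕ) :
    partialXY i j (partialX φ) = partialXY (i + 1) j φ := by
  rw [partialXY, partialXY, Function.iterate_succ_apply, partialX_iterate_partialY_comm h]

theorem partialXY_partialY (i j : ℕ) :
    partialXY i j (partialY φ) = partialXY i (j + 1) φ := rfl

/-- Allows a derivative of a test function to serve as a test function, as in `IsWeakDeriv.trans`.
-/
theorem partialXY_partialXY (h : ContDiff ℝ ∞ φ) (a b i j : ℕ) :
    partialXY a b (partialXY i j φ) = partialXY (i + a) (j + b) φ := by
  have hx : ∀ ψ, ContDiff ℝ ∞ ψ → partialXY a b (partialX^[i] ψ) = partialXY (i + a) b ψ := by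
    induction i with
    | zero => intro ψ _; simp
    | succ i ih =>
      intro ψ hψ
      rw [Function.iterate_succ_apply, ih _ (contDiff_partialX hψ), partialXY_partialX hψ]
      congr 1; omega
  have hy : ∀ ψ, partialXY (i + a) b (partialY^[j] ψ) = partialXY (i + a) (j + b) ψ := by
    intro ψ
    rw [partialXY, partialXY, ← Function.iterate_add_apply, add_comm b j]
  rw [partialXY.eq_def i j, hx _ (contDiff_iterate_partialY h j), hy]

/-- Bridge from the slicewise derivatives in `IsWeakDeriv` to iterated directional derivatives, for
which linearity, symmetry and convolution rules are available. -/
theorem mixedDeriv_eq_partialXY (h : ContDiff ℝ ∞ φ) (i j : ℕ) :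
    mixedDeriv i j φ = partialXY i j φ := by
  have hX : ∀ (i : ℕ) (ψ : ℝ × ℝ → ℝ), ContDiff ℝ ∞ ψ → ∀ x y,
      iteratedDeriv i (fun x => ψ (x, y)) x = (partialX^[i] ψ) (x, y) := by
    intro i
    induction i with
    | zero => intro ψ _ x y; simp
    | succ i ih =>
      intro ψ hψ x y
      rw [iteratedDeriv_succ', Function.iterate_succ_apply, ← ih _ (contDiff_partialX hψ)]
      congr 1
      funext t
      have h1 : HasDerivAt (fun s : ℝ => (s, y)) ((1 : ℝ), (0 : ℝ)) t :=
        (hasDerivAt_id t).prodMk (hasDerivAt_const t y)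
      exact ((smooth_differentiable hψ (t, y)).hasFDerivAt.comp_hasDerivAt t h1).deriv
  have hY : ∀ (i : ℕ) (ψ : ℝ × ℝ → ℝ), ContDiff ℝ ∞ ψ → ∀ x y,
      iteratedDeriv i (fun y => ψ (x, y)) y = (partialY^[i] ψ) (x, y) := by
    intro i
    induction i with
    | zero => intro ψ _ x y; simp
    | succ i ih =>
      intro ψ hψ x y
      rw [iteratedDeriv_succ', Function.iterate_succ_apply, ← ih _ (contDiff_partialY hψ)]
      congr 1
      funext t
      have h1 : HasDerivAt (fun s : ℝ => (x, s)) ((0 : ℝ), (1 : ℝ)) t :=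
        (hasDerivAt_const t x).prodMk (hasDerivAt_id t)
      exact ((smooth_differentiable hψ (x, t)).hasFDerivAt.comp_hasDerivAt t h1).deriv
  funext z
  rw [mixedDeriv, partialXY]
  simp only [hY j φ h]
  exact hX i _ (contDiff_iterate_partialY h j) z.1 z.2

theorem hasCompactSupport_partialX (h : HasCompactSupport φ) : HasCompactSupport (partialX φ) :=
  h.fderiv_apply (𝕜 := ℝ) (1, 0)

theorem hasCompactSupport_partialY (h : HasCompactSupport φ) : HasCompactSupport (partialY φ) :=
  h.fderiv_apply (𝕜 := ℝ) (0, 1)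

theorem tsupport_partialXY_subset (i j : ℕ) : tsupport (partialXY i j φ) ⊆ tsupport φ := by
  have hx : ∀ ψ, tsupport (partialX^[i] ψ) ⊆ tsupport ψ := by
    induction i with
    | zero => intro ψ; rfl
    | succ i ih => intro ψ; exact (ih _).trans (tsupport_fderiv_apply_subset ℝ (1, 0))
  have hy : ∀ ψ, tsupport (partialY^[j] ψ) ⊆ tsupport ψ := by
    induction j with
    | zero => intro ψ; rfl
    | succ i ih => intro ψ; exact (ih _).trans (tsupport_fderiv_apply_subset ℝ (0, 1))
  exact (hx _).trans (hy _)

theorem hasCompactSupport_partialXY (h : HasCompactSupport φ) (i j : ℕ) :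
    HasCompactSupport (partialXY i j φ) :=
  h.of_isClosed_subset (isClosed_tsupport _) (tsupport_partialXY_subset i j)

theorem partialX_add (hφ : ContDiff ℝ ∞ φ) (hψ : ContDiff ℝ ∞ ψ) :
    partialX (φ + ψ) = partialX φ + partialX ψ := by
  funext z
  simp [partialX, fderiv_add (smooth_differentiable hφ z) (smooth_differentiable hψ z)]

theorem partialY_add (hφ : ContDiff ℝ ∞ φ) (hψ : ContDiff ℝ ∞ ψ) :
    partialY (φ + ψ) = partialY φ + partialY ψ := by
  funext z
  simp [partialY, fderiv_add (smooth_differentiable hφ z) (smooth_differentiable hψ z)]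

theorem partialX_smul (hφ : ContDiff ℝ ∞ φ) (c : ℝ) : partialX (c • φ) = c • partialX φ := by
  funext z
  simp [partialX, fderiv_const_smul (smooth_differentiable hφ z)]

theorem partialY_smul (hφ : ContDiff ℝ ∞ φ) (c : ℝ) : partialY (c • φ) = c • partialY φ := by
  funext z
  simp [partialY, fderiv_const_smul (smooth_differentiable hφ z)]

theorem partialXY_add (hφ : ContDiff ℝ ∞ φ) (hψ : ContDiff ℝ ∞ ψ) (i j : ℕ) :
    partialXY i j (φ + ψ) = partialXY i j φ + partialXY i j ψ := by
  induction j generalizing φ ψ with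
  | succ j ih =>
    rw [← partialXY_partialY, partialY_add hφ hψ, ih (contDiff_partialY hφ) (contDiff_partialY hψ)]
    rfl
  | zero =>
    induction i generalizing φ ψ with
    | zero => rfl
    | succ i ih =>
      have hs : ContDiff ℝ ∞ (φ + ψ) := hφ.add hψ
      rw [← partialXY_partialX hs, partialX_add hφ hψ,
        ih (contDiff_partialX hφ) (contDiff_partialX hψ), partialXY_partialX hφ,
        partialXY_partialX hψ]

theorem partialXY_smul (hφ : ContDiff ℝ ∞ φ) (c : ℝ) (i j : ℕ) :
    partialXY i j (c • φ) = c • partialXY i j φ := by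
  induction j generalizing φ with
  | succ j ih =>
    rw [← partialXY_partialY, partialY_smul hφ, ih (contDiff_partialY hφ)]
    rfl
  | zero =>
    induction i generalizing φ with
    | zero => rfl
    | succ i ih =>
      have hs : ContDiff ℝ ∞ (c • φ) := hφ.const_smul c
      rw [← partialXY_partialX hs, partialX_smul hφ,
        ih (contDiff_partialX hφ), partialXY_partialX hφ]

theorem partialXY_sub (hφ : ContDiff ℝ ∞ φ) (hψ : ContDiff ℝ ∞ ψ) (i j : ℕ) :
    partialXY i j (φ - ψ) = partialXY i j φ - partialXY i j ψ := by
  have e : φ - ψ = φ + (-1 : ℝ) • ψ := by simp [sub_eq_add_neg]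
  have h1 : ContDiff ℝ ∞ ((-1 : ℝ) • ψ) := hψ.const_smul (-1 : ℝ)
  rw [e, partialXY_add hφ h1, partialXY_smul hψ]
  simp [sub_eq_add_neg]

theorem contDiff_finset_sum {ι : Type*} (s : Finset ι) {F : ι → ℝ × ℝ → ℝ}
    (hF : ∀ n, ContDiff ℝ ∞ (F n)) : ContDiff ℝ ∞ (∑ n ∈ s, F n) := by
  have := ContDiff.sum (s := s) fun n _ => hF n
  convert this using 1
  funext z; simp

theorem partialXY_sum {ι : Type*} (s : Finset ι) {F : ι → ℝ × ℝ → ℝ}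
    (hF : ∀ n, ContDiff ℝ ∞ (F n)) (i j : ℕ) :
    partialXY i j (∑ n ∈ s, F n) = ∑ n ∈ s, partialXY i j (F n) := by
  classical
  induction s using Finset.induction_on with
  | empty =>
    have := partialXY_smul (φ := 0) contDiff_const 0 i j
    simpa using this
  | insert a s ha ih =>
    rw [Finset.sum_insert ha, Finset.sum_insert ha, partialXY_add (hF a) (contDiff_finset_sum s hF),
      ih]

/-- Partial derivatives of `t ↦ φ (z - t)`. -/
theorem partialXY_comp_sub (hφ : ContDiff ℝ ∞ φ) (z : ℝ × ℝ) (i j : ℕ) (t : ℝ × ℝ) :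
    partialXY i j (fun t => φ (z - t)) t = (-1) ^ (i + j) * partialXY i j φ (z - t) := by
  have key : ∀ (ψ : ℝ × ℝ → ℝ), ContDiff ℝ ∞ ψ → ∀ t : ℝ × ℝ, ∀ e : ℝ × ℝ,
      fderiv ℝ (fun t => ψ (z - t)) t e = - fderiv ℝ ψ (z - t) e := by
    intro ψ hψ t e
    have h1 : HasFDerivAt (fun t : ℝ × ℝ => z - t) (-ContinuousLinearMap.id ℝ (ℝ × ℝ)) t :=
      (hasFDerivAt_id t).const_sub z
    have h2 := (smooth_differentiable hψ (z - t)).hasFDerivAt.comp t h1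
    have h3 : fderiv ℝ (fun t => ψ (z - t)) t = _ := h2.fderiv
    rw [h3]; simp
  have hs : ∀ ψ : ℝ × ℝ → ℝ, ContDiff ℝ ∞ ψ → ContDiff ℝ ∞ (fun t => ψ (z - t)) :=
    fun ψ hψ => hψ.comp (contDiff_const.sub contDiff_id)
  have hX : ∀ ψ : ℝ × ℝ → ℝ, ContDiff ℝ ∞ ψ →
      partialX (fun t => ψ (z - t)) = (-1 : ℝ) • fun t => partialX ψ (z - t) := by
    intro ψ hψ; funext t; simp [partialX, key ψ hψ]
  have hY : ∀ ψ : ℝ × ℝ → ℝ, ContDiff ℝ ∞ ψ →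
      partialY (fun t => ψ (z - t)) = (-1 : ℝ) • fun t => partialY ψ (z - t) := by
    intro ψ hψ; funext t; simp [partialY, key ψ hψ]
  induction j generalizing φ with
  | succ j ih =>
    rw [← partialXY_partialY, hY φ hφ, partialXY_smul (hs _ (contDiff_partialY hφ)), Pi.smul_apply,
      ih (contDiff_partialY hφ), partialXY_partialY, smul_eq_mul]
    ring
  | zero =>
    induction i generalizing φ with
    | zero => simp [partialXY]
    | succ i ih =>
      rw [← partialXY_partialX (hs _ hφ), hX φ hφ, partialXY_smul (hs _ (contDiff_partialX hφ)),
        Pi.smul_apply, ih (contDiff_partialX hφ), partialXY_partialX hφ, smul_eq_mul]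
      ring

end Calculus

/-! ### Taylor's formula -/

/-- The normalized monomial `(x - x₀)ⁱ / i! · (y - y₀)ʲ / j!`. -/
noncomputable def taylorMonomial (z₀ : ℝ × ℝ) (i j : ℕ) (z : ℝ × ℝ) : ℝ :=
  (z.1 - z₀.1) ^ i / i.factorial * ((z.2 - z₀.2) ^ j / j.factorial)

theorem contDiff_taylorMonomial (z₀ : ℝ × ℝ) (i j : ℕ) : ContDiff ℝ ∞ (taylorMonomial z₀ i j) := by
  unfold taylorMonomial
  fun_prop

theorem taylorMonomial_mem_polyQ (z₀ : ℝ × ℝ) {k i j : ℕ} (hi : i ≤ k) (hj : j ≤ k) :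
    taylorMonomial z₀ i j ∈ polyQ k := by
  have h := Submodule.smul_mem _ ((i.factorial : ℝ)⁻¹ * (j.factorial : ℝ)⁻¹)
    (affine_monomial_mem_polyQ hi hj 1 (-z₀.1) 1 (-z₀.2))
  convert h using 1
  funext z
  simp only [taylorMonomial, Pi.smul_apply, smul_eq_mul, one_mul, sub_eq_add_neg]
  ring

theorem taylorMonomial_self (z₀ : ℝ × ℝ) (i j : ℕ) :
    taylorMonomial z₀ i j z₀ = if i = 0 ∧ j = 0 then 1 else 0 := by
  rcases i with _ | i <;> rcases j with _ | j <;> simp [taylorMonomial]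

theorem hasDerivAt_pow_div_factorial (a x : ℝ) (i : ℕ) :
    HasDerivAt (fun x : ℝ => (x - a) ^ (i + 1) / (i + 1).factorial) ((x - a) ^ i / i.factorial) x := by
  have h := (((hasDerivAt_id x).sub_const a).pow (i + 1)).div_const ((i + 1).factorial : ℝ)
  refine HasDerivAt.congr_deriv h ?_
  simp only [id, Nat.factorial_succ, Nat.cast_mul, Nat.add_sub_cancel]
  have : ((i : ℝ) + 1) ≠ 0 := by positivity
  have : ((i.factorial : ℝ)) ≠ 0 := by positivity
  push_cast
  field_simp

/-- Division by the factorials makes differentiation a pure shift of the index, so the coefficients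
of `taylorPoly` are its derivatives at the centre. -/
theorem partialX_taylorMonomial_succ (z₀ : ℝ × ℝ) (i j : ℕ) :
    partialX (taylorMonomial z₀ (i + 1) j) = taylorMonomial z₀ i j := by
  funext z
  have h0 := (smooth_differentiable (contDiff_taylorMonomial z₀ (i + 1) j) z).hasFDerivAt
  have h1 : HasDerivAt (fun s : ℝ => (s, z.2)) ((1 : ℝ), (0 : ℝ)) z.1 :=
    (hasDerivAt_id z.1).prodMk (hasDerivAt_const z.1 z.2)
  have h2 := HasFDerivAt.comp_hasDerivAt (f := fun s : ℝ => (s, z.2)) z.1 h0 h1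
  have h3 := (hasDerivAt_pow_div_factorial z₀.1 z.1 i).mul_const ((z.2 - z₀.2) ^ j / j.factorial)
  exact h2.unique h3

theorem partialY_taylorMonomial_succ (z₀ : ℝ × ℝ) (i j : ℕ) :
    partialY (taylorMonomial z₀ i (j + 1)) = taylorMonomial z₀ i j := by
  funext z
  have h0 := (smooth_differentiable (contDiff_taylorMonomial z₀ i (j + 1)) z).hasFDerivAt
  have h1 : HasDerivAt (fun s : ℝ => (z.1, s)) ((0 : ℝ), (1 : ℝ)) z.2 :=
    (hasDerivAt_const z.2 z.1).prodMk (hasDerivAt_id z.2)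
  have h2 := HasFDerivAt.comp_hasDerivAt (f := fun s : ℝ => (z.1, s)) z.2 h0 h1
  have h3 := (hasDerivAt_pow_div_factorial z₀.2 z.2 j).const_mul ((z.1 - z₀.1) ^ i / i.factorial)
  exact h2.unique h3

theorem partialX_taylorMonomial_zero (z₀ : ℝ × ℝ) (j : ℕ) :
    partialX (taylorMonomial z₀ 0 j) = 0 := by
  funext z
  have h0 := (smooth_differentiable (contDiff_taylorMonomial z₀ 0 j) z).hasFDerivAt
  have h1 : HasDerivAt (fun s : ℝ => (s, z.2)) ((1 : ℝ), (0 : ℝ)) z.1 :=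
    (hasDerivAt_id z.1).prodMk (hasDerivAt_const z.1 z.2)
  have h2 := HasFDerivAt.comp_hasDerivAt (f := fun s : ℝ => (s, z.2)) z.1 h0 h1
  have h3 : HasDerivAt (taylorMonomial z₀ 0 j ∘ fun s : ℝ => (s, z.2)) 0 z.1 := by
    have : (taylorMonomial z₀ 0 j ∘ fun s : ℝ => (s, z.2))
        = fun _ => (z.2 - z₀.2) ^ j / j.factorial := by
      funext s; simp [taylorMonomial]
    rw [this]; exact hasDerivAt_const _ _
  exact h2.unique h3

theorem partialY_taylorMonomial_zero (z₀ : ℝ × ℝ) (i : ℕ) :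
    partialY (taylorMonomial z₀ i 0) = 0 := by
  funext z
  have h0 := (smooth_differentiable (contDiff_taylorMonomial z₀ i 0) z).hasFDerivAt
  have h1 : HasDerivAt (fun s : ℝ => (z.1, s)) ((0 : ℝ), (1 : ℝ)) z.2 :=
    (hasDerivAt_const z.2 z.1).prodMk (hasDerivAt_id z.2)
  have h2 := HasFDerivAt.comp_hasDerivAt (f := fun s : ℝ => (z.1, s)) z.2 h0 h1
  have h3 : HasDerivAt (taylorMonomial z₀ i 0 ∘ fun s : ℝ => (z.1, s)) 0 z.2 := by
    have : (taylorMonomial z₀ i 0 ∘ fun s : ℝ => (z.1, s))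
        = fun _ => (z.1 - z₀.1) ^ i / i.factorial := by
      funext s; simp [taylorMonomial]
    rw [this]; exact hasDerivAt_const _ _
  exact h2.unique h3

theorem partialXY_zero (i j : ℕ) : partialXY i j 0 = 0 := by
  simpa using partialXY_smul (φ := 0) contDiff_const 0 i j

theorem partialXY_taylorMonomial (z₀ : ℝ × ℝ) (a b i j : ℕ) :
    partialXY a b (taylorMonomial z₀ i j)
      = if a ≤ i ∧ b ≤ j then taylorMonomial z₀ (i - a) (j - b) else 0 := by
  induction b generalizing j with
  | succ b ih =>
    rw [← partialXY_partialY]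
    rcases j with _ | j
    · rw [partialY_taylorMonomial_zero, partialXY_zero]; simp
    · rw [partialY_taylorMonomial_succ, ih]; simp
  | zero =>
    induction a generalizing i with
    | zero => simp [partialXY]
    | succ a ih =>
      rw [← partialXY_partialX (contDiff_taylorMonomial _ _ _)]
      rcases i with _ | i
      · rw [partialX_taylorMonomial_zero, partialXY_zero]; simp
      · rw [partialX_taylorMonomial_succ, ih]; simp

/-- The polynomial of total degree less than `m` with derivatives `c i j` at `z₀`. -/
noncomputable def taylorPoly (m : ℕ) (c : ℕ → ℕ → ℝ) (z₀ : ℝ × ℝ) : ℝ × ℝ → ℝ :=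
  ∑ p ∈ (Finset.range m ×ˢ Finset.range m).filter (fun p => p.1 + p.2 < m),
    c p.1 p.2 • taylorMonomial z₀ p.1 p.2

theorem contDiff_taylorPoly (m : ℕ) (c : ℕ → ℕ → ℝ) (z₀ : ℝ × ℝ) :
    ContDiff ℝ ∞ (taylorPoly m c z₀) :=
  contDiff_finset_sum _ fun p => (contDiff_taylorMonomial z₀ p.1 p.2).const_smul (c p.1 p.2)

theorem taylorPoly_mem_polyQ {m k : ℕ} (hm : m ≤ k + 1) (c : ℕ → ℕ → ℝ) (z₀ : ℝ × ℝ) :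
    taylorPoly m c z₀ ∈ polyQ k := by
  refine Submodule.sum_mem _ fun p hp => Submodule.smul_mem _ _ ?_
  simp only [Finset.mem_filter, Finset.mem_product, Finset.mem_range] at hp
  exact taylorMonomial_mem_polyQ _ (by omega) (by omega)

theorem partialXY_taylorPoly (m : ℕ) (c : ℕ → ℕ → ℝ) (z₀ : ℝ × ℝ) (a b : ℕ) :
    partialXY a b (taylorPoly m c z₀)
      = ∑ p ∈ (Finset.range m ×ˢ Finset.range m).filter (fun p => p.1 + p.2 < m),
        c p.1 p.2 • partialXY a b (taylorMonomial z₀ p.1 p.2) := by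
  rw [taylorPoly, partialXY_sum (F := fun p : ℕ × ℕ => c p.1 p.2 • taylorMonomial z₀ p.1 p.2) _
    fun p => (contDiff_taylorMonomial z₀ p.1 p.2).const_smul (c p.1 p.2)]
  exact Finset.sum_congr rfl fun p _ => partialXY_smul (contDiff_taylorMonomial _ _ _) _ _ _

theorem partialXY_taylorPoly_self {m : ℕ} (c : ℕ → ℕ → ℝ) (z₀ : ℝ × ℝ) {a b : ℕ} (hab : a + b < m) :
    partialXY a b (taylorPoly m c z₀) z₀ = c a b := by
  rw [partialXY_taylorPoly, Finset.sum_apply, Finset.sum_eq_single (a, b)]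
  · simp [partialXY_taylorMonomial, taylorMonomial_self]
  · intro p _ hne
    rw [Pi.smul_apply, partialXY_taylorMonomial]
    split_ifs with h
    · rw [taylorMonomial_self, if_neg, smul_zero]
      rintro ⟨h1, h2⟩
      exact hne (Prod.ext (by simp only; omega) (by simp only; omega))
    · simp
  · intro h
    simp only [Finset.mem_filter, Finset.mem_product, Finset.mem_range] at h
    omega

theorem partialXY_taylorPoly_of_le {m : ℕ} (c : ℕ → ℕ → ℝ) (z₀ : ℝ × ℝ) {a b : ℕ} (hab : m ≤ a + b) :
    partialXY a b (taylorPoly m c z₀) = 0 := by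
  rw [partialXY_taylorPoly]
  refine Finset.sum_eq_zero fun p hp => ?_
  simp only [Finset.mem_filter, Finset.mem_product, Finset.mem_range] at hp
  rw [partialXY_taylorMonomial, if_neg (by omega), smul_zero]

/-- A smooth function whose derivatives of order less than `m` vanish at `z₀` is small near `z₀`. -/
theorem abs_le_of_partialXY_eq_zero {K : Set (ℝ × ℝ)} (hK : Convex ℝ K) {z₀ : ℝ × ℝ} (hz₀ : z₀ ∈ K)
    {hx hy : ℝ} (hx0 : 0 < hx) (hy0 : 0 < hy)
    (hdx : ∀ z ∈ K, |z.1 - z₀.1| ≤ hx) (hdy : ∀ z ∈ K, |z.2 - z₀.2| ≤ hy) (m : ℕ) :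
    ∀ (A : ℝ) (f : ℝ × ℝ → ℝ), ContDiff ℝ ∞ f → (∀ i j, i + j < m → partialXY i j f z₀ = 0) →
      (∀ i j, i + j = m → ∀ z ∈ K, hx ^ i * hy ^ j * |partialXY i j f z| ≤ A) →
      ∀ z ∈ K, |f z| ≤ 2 ^ m * A := by
  induction m with
  | zero => intro A f _ _ h z hz; simpa [partialXY] using h 0 0 rfl z hz
  | succ m ih =>
    intro A f hf h0 hA z hz
    -- One factor `hx` of the anisotropic weight is used up by the derivative, hence `A / hx`.
    have b1 : ∀ z ∈ K, |partialX f z| ≤ 2 ^ m * (A / hx) := by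
      refine ih (A / hx) _ (contDiff_partialX hf) (fun i j hij => ?_) (fun i j hij w hw => ?_)
      · rw [partialXY_partialX hf]; exact h0 _ _ (by omega)
      · rw [partialXY_partialX hf, le_div_iff₀ hx0]
        calc _ = hx ^ (i + 1) * hy ^ j * |partialXY (i + 1) j f w| := by ring
          _ ≤ A := hA _ _ (by omega) w hw
    have b2 : ∀ z ∈ K, |partialY f z| ≤ 2 ^ m * (A / hy) := by
      refine ih (A / hy) _ (contDiff_partialY hf) (fun i j hij => ?_) (fun i j hij w hw => ?_)
      · rw [partialXY_partialY]; exact h0 _ _ (by omega)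
      · rw [partialXY_partialY, le_div_iff₀ hy0]
        calc _ = hx ^ i * hy ^ (j + 1) * |partialXY i (j + 1) f w| := by ring
          _ ≤ A := hA _ _ (by omega) w hw
    have hmem : ∀ t ∈ Icc (0 : ℝ) 1, z₀ + t • (z - z₀) ∈ K := fun t ht =>
      hK.add_smul_sub_mem hz₀ hz ht
    have hd : ∀ t ∈ Icc (0 : ℝ) 1, HasDerivWithinAt (fun t : ℝ => f (z₀ + t • (z - z₀)))
        (fderiv ℝ f (z₀ + t • (z - z₀)) (z - z₀)) (Icc 0 1) t := by
      intro t _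
      have h1 : HasDerivAt (fun t : ℝ => z₀ + t • (z - z₀)) (z - z₀) t := by
        simpa using ((hasDerivAt_id t).smul_const (z - z₀)).const_add z₀
      exact ((smooth_differentiable hf _).hasFDerivAt.comp_hasDerivAt t h1).hasDerivWithinAt
    -- The two partial derivatives contribute `2 ^ m * A` each, which doubles the constant at every
    -- order.
    have hb : ∀ t ∈ Icc (0 : ℝ) 1, ‖fderiv ℝ f (z₀ + t • (z - z₀)) (z - z₀)‖ ≤ 2 ^ (m + 1) * A := by
      intro t ht
      set w := z₀ + t • (z - z₀)
      have hw : w ∈ K := hmem t ht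
      have e : fderiv ℝ f w (z - z₀)
          = (z.1 - z₀.1) * partialX f w + (z.2 - z₀.2) * partialY f w := by
        have e1 : z - z₀ = (z.1 - z₀.1) • ((1 : ℝ), (0 : ℝ)) + (z.2 - z₀.2) • ((0 : ℝ), (1 : ℝ)) := by
          ext <;> simp
        rw [e1, map_add, map_smul, map_smul]; rfl
      rw [e, Real.norm_eq_abs]
      calc _ ≤ |z.1 - z₀.1| * |partialX f w| + |z.2 - z₀.2| * |partialY f w| := by
            rw [← abs_mul, ← abs_mul]; exact abs_add_le _ _
        _ ≤ hx * (2 ^ m * (A / hx)) + hy * (2 ^ m * (A / hy)) :=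
            add_le_add
              (mul_le_mul (hdx z hz) (b1 w hw) (abs_nonneg _) hx0.le)
              (mul_le_mul (hdy z hz) (b2 w hw) (abs_nonneg _) hy0.le)
        _ = _ := by field_simp; ring
    have hmv := (convex_Icc (0 : ℝ) 1).norm_image_sub_le_of_norm_hasDerivWithin_le hd hb
      (left_mem_Icc.2 zero_le_one) (right_mem_Icc.2 zero_le_one)
    have hfz : f z₀ = 0 := h0 0 0 (by omega)
    simpa [hfz] using hmv

/-- Taylor's formula with the derivatives at `z₀` as coefficients. -/
theorem abs_sub_taylorPoly_le {K : Set (ℝ × ℝ)} (hK : Convex ℝ K) {z₀ : ℝ × ℝ} (hz₀ : z₀ ∈ K)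
    {hx hy : ℝ} (hx0 : 0 < hx) (hy0 : 0 < hy)
    (hdx : ∀ z ∈ K, |z.1 - z₀.1| ≤ hx) (hdy : ∀ z ∈ K, |z.2 - z₀.2| ≤ hy) {m : ℕ}
    {A : ℝ} {f : ℝ × ℝ → ℝ} (hf : ContDiff ℝ ∞ f)
    (hA : ∀ i j, i + j = m → ∀ z ∈ K, hx ^ i * hy ^ j * |partialXY i j f z| ≤ A)
    {z : ℝ × ℝ} (hz : z ∈ K) :
    |f z - taylorPoly m (fun i j => partialXY i j f z₀) z₀ z| ≤ 2 ^ m * A := by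
  refine abs_le_of_partialXY_eq_zero hK hz₀ hx0 hy0 hdx hdy m A
    (f - taylorPoly m (fun i j => partialXY i j f z₀) z₀) (hf.sub (contDiff_taylorPoly _ _ _))
    (fun i j hij => ?_) (fun i j hij w hw => ?_) z hz
  · rw [partialXY_sub hf (contDiff_taylorPoly _ _ _), Pi.sub_apply,
      partialXY_taylorPoly_self _ _ hij, sub_self]
  · rw [partialXY_sub hf (contDiff_taylorPoly _ _ _), partialXY_taylorPoly_of_le _ _ hij.ge, sub_zero]
    exact hA i j hij w hw

/-! ### Weak derivatives -/

theorem isOpen_unitSquare : IsOpen unitSquare := isOpen_Ioo.prod isOpen_Ioo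

theorem measurableSet_unitSquare : MeasurableSet unitSquare := isOpen_unitSquare.measurableSet

theorem volume_unitSquare_lt_top : volume unitSquare < (⊤ : ℝ≥0∞) :=
  (measure_mono (Set.prod_mono Ioo_subset_Icc_self Ioo_subset_Icc_self)).trans_lt
    (isCompact_Icc.prod isCompact_Icc : IsCompact (Icc (0 : ℝ) 1 ×ˢ Icc (0 : ℝ) 1)).measure_lt_top

theorem integrableOn_unitSquare_of_bounded {v : ℝ × ℝ → ℝ} (hv : LocallyIntegrableOn v unitSquare)
    {M : ℝ} (hM : ∀ᵐ z ∂volume.restrict unitSquare, |v z| ≤ M) : IntegrableOn v unitSquare :=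
  ⟨hv.aestronglyMeasurable,
    HasFiniteIntegral.restrict_of_bounded M volume_unitSquare_lt_top hM⟩

theorem integrableOn_mul_smooth {w φ : ℝ × ℝ → ℝ} (hw : LocallyIntegrableOn w unitSquare)
    (hφ : Continuous φ) (hc : HasCompactSupport φ) (hs : tsupport φ ⊆ unitSquare) :
    IntegrableOn (fun z => w z * φ z) unitSquare := by
  have h1 : IntegrableOn (fun z => w z * φ z) (tsupport φ) :=
    (hw.integrableOn_compact_subset hs hc).mul_continuousOn hφ.continuousOn hc
  refine IntegrableOn.of_forall_sdiff_eq_zero h1 measurableSet_unitSquare fun z hz => ?_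
  rw [image_eq_zero_of_notMem_tsupport hz.2, mul_zero]

/-- Testing the lower derivative of `v` with `partialXY i j φ` produces the same integral as testing
the higher one with `φ`; the common sign `(-1) ^ (a + b)` cancels. -/
theorem IsWeakDeriv.trans {a b i j : ℕ} {v w w' : ℝ × ℝ → ℝ} (h : IsWeakDeriv a b v w)
    (h' : IsWeakDeriv (a + i) (b + j) v w') : IsWeakDeriv i j w w' := by
  refine ⟨h.2.1, h'.2.1, fun φ hφ hc hs => ?_⟩
  have hψ := contDiff_partialXY hφ i j
  have h1 := h.2.2 (partialXY i j φ) hψ (hasCompactSupport_partialXY hc i j)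
    ((tsupport_partialXY_subset i j).trans hs)
  have h2 := h'.2.2 φ hφ hc hs
  rw [mixedDeriv_eq_partialXY hψ, partialXY_partialXY hφ, add_comm i a, add_comm j b] at h1
  rw [mixedDeriv_eq_partialXY hφ, h1] at h2
  rw [mixedDeriv_eq_partialXY hφ]
  have e : (-1 : ℝ) ^ (a + b) * (-1 : ℝ) ^ (a + b) = 1 := by
    rw [← mul_pow]; simp
  calc _ = (-1 : ℝ) ^ (a + b) * ((-1 : ℝ) ^ (a + b) * ∫ z in unitSquare, w z * partialXY i j φ z) := by
        rw [← mul_assoc, e, one_mul]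
    _ = ((-1 : ℝ) ^ (a + b) * (-1 : ℝ) ^ (a + b)) * ((-1 : ℝ) ^ (i + j) *
          ∫ z in unitSquare, w' z * φ z) := by rw [h2]; ring
    _ = _ := by rw [e, one_mul]

theorem LocallyIntegrableOn.congr_ae_unitSquare {v w : ℝ × ℝ → ℝ}
    (hv : LocallyIntegrableOn v unitSquare) (h : v =ᵐ[volume.restrict unitSquare] w) :
    LocallyIntegrableOn w unitSquare := by
  rw [locallyIntegrableOn_iff isOpen_unitSquare.isLocallyClosed] at hv ⊢
  intro K hK hKc
  exact (hv K hK hKc).congr (ae_restrict_of_ae_restrict_of_subset hK h)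

theorem IsWeakDeriv.congr_left {i j : ℕ} {v v' w : ℝ × ℝ → ℝ} (h : IsWeakDeriv i j v w)
    (hv : v =ᵐ[volume.restrict unitSquare] v') : IsWeakDeriv i j v' w := by
  refine ⟨LocallyIntegrableOn.congr_ae_unitSquare h.1 hv, h.2.1, fun φ hφ hc hs => ?_⟩
  rw [← h.2.2 φ hφ hc hs]
  refine integral_congr_ae ?_
  filter_upwards [hv] with z hz
  rw [hz]

theorem IsWeakDeriv.add {i j : ℕ} {v v' w w' : ℝ × ℝ → ℝ} (h : IsWeakDeriv i j v w)
    (h' : IsWeakDeriv i j v' w') : IsWeakDeriv i j (v + v') (w + w') := by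
  refine ⟨h.1.add h'.1, h.2.1.add h'.2.1, fun φ hφ hc hs => ?_⟩
  have h1 := h.2.2 φ hφ hc hs
  have h2 := h'.2.2 φ hφ hc hs
  rw [mixedDeriv_eq_partialXY hφ] at h1 h2 ⊢
  have hψ := (contDiff_partialXY hφ i j).continuous
  have hψc := hasCompactSupport_partialXY hc i j
  have hψs := (tsupport_partialXY_subset (φ := φ) i j).trans hs
  simp only [Pi.add_apply, add_mul]
  rw [integral_add (integrableOn_mul_smooth h.1 hψ hψc hψs)
      (integrableOn_mul_smooth h'.1 hψ hψc hψs), h1, h2,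
    integral_add (integrableOn_mul_smooth h.2.1 hφ.continuous hc hs)
      (integrableOn_mul_smooth h'.2.1 hφ.continuous hc hs)]
  ring

theorem IsWeakDeriv.ae_eq {i j : ℕ} {v w w' : ℝ × ℝ → ℝ} (h : IsWeakDeriv i j v w)
    (h' : IsWeakDeriv i j v w') : w =ᵐ[volume.restrict unitSquare] w' := by
  have key : ∀ᵐ z ∂(volume : Measure (ℝ × ℝ)), z ∈ unitSquare → w z - w' z = 0 := by
    refine isOpen_unitSquare.ae_eq_zero_of_integral_contDiff_smul_eq_zero
      (h.2.1.sub h'.2.1) fun φ hφ hc hs => ?_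
    have h1 := (h.2.2 φ hφ hc hs).symm.trans (h'.2.2 φ hφ hc hs)
    have h2 : ∫ z in unitSquare, w z * φ z = ∫ z in unitSquare, w' z * φ z :=
      mul_left_cancel₀ (by positivity) h1
    rw [← setIntegral_eq_integral_of_forall_compl_eq_zero (s := unitSquare)]
    · simp only [smul_eq_mul]
      simp only [mul_comm (φ _), sub_mul]
      rw [integral_sub (integrableOn_mul_smooth h.2.1 hφ.continuous hc hs)
        (integrableOn_mul_smooth h'.2.1 hφ.continuous hc hs), h2, sub_self]
    · intro z hz
      rw [image_eq_zero_of_notMem_tsupport fun hz' => hz (hs hz'), zero_smul]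
  filter_upwards [(ae_restrict_iff' measurableSet_unitSquare).2 key] with z hz
  exact sub_eq_zero.1 hz

theorem weakDeriv_ae_eq {i j : ℕ} {v w : ℝ × ℝ → ℝ} (h : IsWeakDeriv i j v w) :
    weakDeriv i j v =ᵐ[volume.restrict unitSquare] w := by
  have hex : ∃ w, IsWeakDeriv i j v w := ⟨w, h⟩
  rw [weakDeriv, dif_pos hex]
  exact hex.choose_spec.ae_eq h

/-- A function `w 0 0` with integrable weak derivatives `w i j` up to order `m`. -/
def IsWeakJet (m : ℕ) (w : ℕ → ℕ → ℝ × ℝ → ℝ) : Prop :=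
  ∀ i j, i + j ≤ m → IsWeakDeriv i j (w 0 0) (w i j) ∧ IntegrableOn (w i j) unitSquare

/-- Makes every approximation result for functions available for their derivatives, at the price of
the order already spent. -/
theorem IsWeakJet.shift {m : ℕ} {w : ℕ → ℕ → ℝ × ℝ → ℝ} {a b : ℕ} (h : IsWeakJet (m + a + b) w) :
    IsWeakJet m (fun i j => w (a + i) (b + j)) := fun i j hij =>
  ⟨(h a b (by omega)).1.trans (h (a + i) (b + j) (by omega)).1, (h _ _ (by omega)).2⟩

theorem exists_isWeakJet {m : ℕ} {C : ℝ} {W : ℕ → ℕ → ℝ × ℝ → ℝ} {v : ℝ × ℝ → ℝ}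
    (h : HasDerivBounds m C W v)
    (hW : ∀ i j, i + j ≤ m → ∃ M, ∀ z ∈ unitSquare, C * W i j z ≤ M) :
    ∃ w : ℕ → ℕ → ℝ × ℝ → ℝ, v =ᵐ[volume.restrict unitSquare] w 0 0 ∧ IsWeakJet m w ∧
      ∀ i j, i + j ≤ m → ∀ᵐ z ∂volume.restrict unitSquare, |w i j z| ≤ C * W i j z := by
  choose! w hw using h
  -- The chosen derivative of order zero replaces `v` as the base of the jet; `v` is its own weak
  -- derivative of order zero, and weak derivatives are unique.
  have h0 : v =ᵐ[volume.restrict unitSquare] w 0 0 := by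
    have h1 := (hw 0 0 (by omega)).1
    have hself : IsWeakDeriv 0 0 v v :=
      ⟨h1.1, h1.1, fun φ hφ _ _ => by rw [mixedDeriv_eq_partialXY hφ]; simp [partialXY]⟩
    exact hself.ae_eq h1
  refine ⟨w, h0, fun i j hij => ⟨(hw i j hij).1.congr_left h0, ?_⟩, fun i j hij => (hw i j hij).2⟩
  obtain ⟨M, hM⟩ := hW i j hij
  refine integrableOn_unitSquare_of_bounded (hw i j hij).1.2.1 (M := M) ?_
  filter_upwards [(hw i j hij).2, ae_restrict_mem measurableSet_unitSquare] with z hz hzm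
  exact hz.trans (hM z hzm)

/-! ### Mollification -/

/-- A sequence of bump functions shrinking to the origin. -/
noncomputable def bump (n : ℕ) : ContDiffBump (0 : ℝ × ℝ) where
  rIn := 1 / (2 * ((n : ℝ) + 1))
  rOut := 1 / ((n : ℝ) + 1)
  rIn_pos := by positivity
  rIn_lt_rOut := one_div_lt_one_div_of_lt (by positivity) (by linarith [n.cast_nonneg (α := ℝ)])

/-- The mollification of `v`, extended by zero outside of `Ω`. -/
noncomputable def mollify (v : ℝ × ℝ → ℝ) (n : ℕ) : ℝ × ℝ → ℝ :=
  convolution (unitSquare.indicator v) ((bump n).normed volume) (ContinuousLinearMap.lsmul ℝ ℝ) volume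

theorem tendsto_bump_rOut : Tendsto (fun n => (bump n).rOut) atTop (𝓝 0) :=
  tendsto_one_div_add_atTop_nhds_zero_nat

theorem contDiff_bump (n : ℕ) : ContDiff ℝ ∞ ((bump n).normed volume) :=
  (bump n).contDiff_normed (n := ⊤)

theorem contDiff_convolution {f ρ : ℝ × ℝ → ℝ} (hf : LocallyIntegrable f) (hρ : ContDiff ℝ ∞ ρ)
    (hc : HasCompactSupport ρ) :
    ContDiff ℝ ∞ (convolution f ρ (ContinuousLinearMap.lsmul ℝ ℝ) volume) :=
  hc.contDiff_convolution_right (n := ⊤) _ hf hρ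

theorem fderiv_convolution_apply {f ρ : ℝ × ℝ → ℝ} (hf : LocallyIntegrable f) (hρ : ContDiff ℝ ∞ ρ)
    (hc : HasCompactSupport ρ) (z e : ℝ × ℝ) :
    fderiv ℝ (convolution f ρ (ContinuousLinearMap.lsmul ℝ ℝ) volume) z e
      = convolution f (fun t => fderiv ℝ ρ t e) (ContinuousLinearMap.lsmul ℝ ℝ) volume z := by
  rw [(hc.hasFDerivAt_convolution_right (ContinuousLinearMap.lsmul ℝ ℝ) hf
    (hρ.of_le (by exact WithTop.coe_le_coe.2 le_top)) z).fderiv]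
  exact convolution_precompR_apply _ hf (hc.fderiv ℝ) (hρ.continuous_fderiv (by simp)) _ _

theorem partialXY_convolution {f ρ : ℝ × ℝ → ℝ} (hf : LocallyIntegrable f) (hρ : ContDiff ℝ ∞ ρ)
    (hc : HasCompactSupport ρ) (i j : ℕ) :
    partialXY i j (convolution f ρ (ContinuousLinearMap.lsmul ℝ ℝ) volume)
      = convolution f (partialXY i j ρ) (ContinuousLinearMap.lsmul ℝ ℝ) volume := by
  induction j generalizing ρ with
  | succ j ih =>
    rw [← partialXY_partialY, ← partialXY_partialY,
      ← ih (contDiff_partialY hρ) (hasCompactSupport_partialY hc)]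
    congr 1
    funext z
    exact fderiv_convolution_apply hf hρ hc z _
  | zero =>
    induction i generalizing ρ with
    | zero => rfl
    | succ i ih =>
      rw [← partialXY_partialX (contDiff_convolution hf hρ hc), ← partialXY_partialX hρ,
        ← ih (contDiff_partialX hρ) (hasCompactSupport_partialX hc)]
      congr 1
      funext z
      exact fderiv_convolution_apply hf hρ hc z _

theorem locallyIntegrable_indicator {v : ℝ × ℝ → ℝ} (hv : IntegrableOn v unitSquare) :
    LocallyIntegrable (unitSquare.indicator v) :=
  (hv.integrable_indicator measurableSet_unitSquare).locallyIntegrable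

theorem contDiff_mollify {v : ℝ × ℝ → ℝ} (hv : IntegrableOn v unitSquare) (n : ℕ) :
    ContDiff ℝ ∞ (mollify v n) :=
  contDiff_convolution (locallyIntegrable_indicator hv) (contDiff_bump n)
    (bump n).hasCompactSupport_normed

theorem convolution_indicator (v ρ : ℝ × ℝ → ℝ) (z : ℝ × ℝ) :
    convolution (unitSquare.indicator v) ρ (ContinuousLinearMap.lsmul ℝ ℝ) volume z
      = ∫ t in unitSquare, v t * ρ (z - t) := by
  rw [convolution_def, ← integral_indicator measurableSet_unitSquare]
  refine integral_congr_ae (Eventually.of_forall fun t => ?_)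
  by_cases ht : t ∈ unitSquare <;> simp [ht]

/-- The derivative falls on the kernel, and `t ↦ ρ (z - t)` is an admissible test function when the
ball around `z` lies in the domain. The signs from reflection and from the weak derivative cancel.
-/
theorem partialXY_mollify {i j : ℕ} {v w : ℝ × ℝ → ℝ} (hv : IntegrableOn v unitSquare)
    (h : IsWeakDeriv i j v w) {n : ℕ} {z : ℝ × ℝ}
    (hz : Metric.closedBall z (bump n).rOut ⊆ unitSquare) :
    partialXY i j (mollify v n) z = mollify w n z := by
  set ρ := (bump n).normed volume with hρdef
  have hρ : ContDiff ℝ ∞ ρ := contDiff_bump n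
  have hρz : ContDiff ℝ ∞ (fun t => ρ (z - t)) := hρ.comp (contDiff_const.sub contDiff_id)
  have hsupp : tsupport (fun t => ρ (z - t)) ⊆ Metric.closedBall z (bump n).rOut := by
    refine closure_minimal (fun t ht => ?_) Metric.isClosed_closedBall
    have : z - t ∈ Function.support ρ := ht
    rw [hρdef, (bump n).support_normed_eq, mem_ball_zero_iff] at this
    rw [Metric.mem_closedBall, dist_comm, dist_eq_norm]
    exact this.le
  have hcomp : HasCompactSupport (fun t => ρ (z - t)) :=
    (isCompact_closedBall z _).of_isClosed_subset (isClosed_tsupport _) hsupp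
  have h1 := h.2.2 _ hρz hcomp (hsupp.trans hz)
  rw [mixedDeriv_eq_partialXY hρz] at h1
  rw [mollify, partialXY_convolution (locallyIntegrable_indicator hv) hρ
    (bump n).hasCompactSupport_normed, mollify, convolution_indicator, convolution_indicator]
  simp only [partialXY_comp_sub hρ] at h1
  have e : ∀ t, v t * ((-1 : ℝ) ^ (i + j) * partialXY i j ρ (z - t))
      = (-1 : ℝ) ^ (i + j) * (v t * partialXY i j ρ (z - t)) := fun t => by ring
  simp only [e, integral_const_mul] at h1
  exact mul_left_cancel₀ (by positivity) h1

/-- The kernel is nonnegative with integral one and sees only `R`. Points of `R` outside the domain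
carry the value zero, whence `0 ≤ M`. -/
theorem abs_mollify_le {w : ℝ × ℝ → ℝ} {R : Set (ℝ × ℝ)} (hRm : MeasurableSet R) {M : ℝ}
    (hM0 : 0 ≤ M) (hM : ∀ᵐ z ∂volume.restrict R, |w z| ≤ M) {n : ℕ} {z : ℝ × ℝ}
    (hz : Metric.closedBall z (bump n).rOut ⊆ R) : |mollify w n z| ≤ M := by
  set ρ := (bump n).normed volume with hρdef
  have hint : Integrable (fun t => M * ρ (z - t)) :=
    ((bump n).integrable_normed.comp_sub_left z).const_mul M
  have h1 : ‖mollify w n z‖ ≤ ∫ t, M * ρ (z - t) := by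
    rw [mollify, convolution_def]
    refine norm_integral_le_of_norm_le hint ?_
    filter_upwards [(ae_restrict_iff' hRm).1 hM] with t ht
    have hρ0 : 0 ≤ ρ (z - t) := (bump n).nonneg_normed _
    rw [ContinuousLinearMap.lsmul_apply, smul_eq_mul, norm_mul, Real.norm_eq_abs, Real.norm_eq_abs,
      abs_of_nonneg hρ0]
    by_cases hb : z - t ∈ Function.support ρ
    · rw [hρdef, (bump n).support_normed_eq, mem_ball_zero_iff] at hb
      have htR : t ∈ R := hz (by
        rw [Metric.mem_closedBall, dist_comm, dist_eq_norm]; exact hb.le)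
      refine mul_le_mul_of_nonneg_right ?_ hρ0
      by_cases hu : t ∈ unitSquare
      · simpa [hu] using ht htR
      · simpa [hu] using hM0
    · rw [Function.notMem_support.1 hb, mul_zero, mul_zero]
  rw [Real.norm_eq_abs, integral_const_mul, integral_sub_left_eq_self ρ volume z, hρdef,
    (bump n).integral_normed, mul_one] at h1
  exact h1

theorem ae_tendsto_mollify {v : ℝ × ℝ → ℝ} (hv : IntegrableOn v unitSquare) :
    ∀ᵐ z ∂volume.restrict unitSquare, Tendsto (fun n => mollify v n z) atTop (𝓝 (v z)) := by
  -- `K := 2` is the constant ratio of outer to inner radius of the bumps.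
  have h := ContDiffBump.ae_convolution_tendsto_right_of_locallyIntegrable (φ := bump) (l := atTop)
    (K := 2) (μ := (volume : Measure (ℝ × ℝ))) tendsto_bump_rOut
    (Eventually.of_forall fun n => by
      simp only [bump]
      have : ((n : ℝ) + 1) ≠ 0 := by positivity
      apply le_of_eq; field_simp)
    (locallyIntegrable_indicator hv)
  filter_upwards [ae_restrict_of_ae h, ae_restrict_mem measurableSet_unitSquare] with z hz hzm
  rw [indicator_of_mem hzm] at hz
  refine hz.congr fun n => ?_
  rw [mollify, convolution_def, convolution_lsmul_swap]
  simp [mul_comm]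

/-! ### Polynomial approximation of Sobolev functions -/

/-- Taylor's formula holds for the mollified functions along the segment from `z₀` to `z`, with the
bounds `M` intact, and passes to the limit. The lower derivatives enter only through their
convergence at `z₀`; no bound on them is needed. -/
theorem abs_sub_taylorPoly_weak_le {m : ℕ} {w : ℕ → ℕ → ℝ × ℝ → ℝ} (hw : IsWeakJet m w)
    {R : Set (ℝ × ℝ)} (hR : IsOpen R) (hRc : Convex ℝ R) (hRΩ : R ⊆ unitSquare) {M : ℕ → ℕ → ℝ}
    (hM0 : ∀ i j, 0 ≤ M i j)
    (hM : ∀ i j, i + j = m → ∀ᵐ z ∂volume.restrict R, |w i j z| ≤ M i j)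
    {z₀ z : ℝ × ℝ} (hz₀ : z₀ ∈ R) (hz : z ∈ R)
    (ht₀ : ∀ i j, i + j < m → Tendsto (fun n => mollify (w i j) n z₀) atTop (𝓝 (w i j z₀)))
    (ht : Tendsto (fun n => mollify (w 0 0) n z) atTop (𝓝 (w 0 0 z)))
    {hx hy A : ℝ} (hx0 : 0 < hx) (hy0 : 0 < hy) (hdx : |z.1 - z₀.1| ≤ hx) (hdy : |z.2 - z₀.2| ≤ hy)
    (hA : ∀ i j, i + j = m → hx ^ i * hy ^ j * M i j ≤ A) :
    |w 0 0 z - taylorPoly m (fun i j => w i j z₀) z₀ z| ≤ 2 ^ m * A := by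
  have hKc : IsCompact (segment ℝ z₀ z) := by
    rw [segment_eq_image']
    exact isCompact_Icc.image (by fun_prop)
  have hKR : segment ℝ z₀ z ⊆ R := hRc.segment_subset hz₀ hz
  -- The segment is compact in the open set `R`, so one mollification radius works for all of its
  -- points.
  obtain ⟨δ, hδ, hδR⟩ := hKc.exists_cthickening_subset_open hR hKR
  have hball : ∀ᶠ n in atTop, ∀ x ∈ segment ℝ z₀ z, Metric.closedBall x (bump n).rOut ⊆ R := by
    filter_upwards [tendsto_bump_rOut.eventually (gt_mem_nhds hδ)] with n hn x hxs
    exact (Metric.closedBall_subset_closedBall hn.le).trans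
      ((Metric.closedBall_subset_cthickening hxs δ).trans hδR)
  have hdist : ∀ x ∈ segment ℝ z₀ z, |x.1 - z₀.1| ≤ hx ∧ |x.2 - z₀.2| ≤ hy := by
    intro x hxs
    rw [segment_eq_image'] at hxs
    obtain ⟨t, ht, rfl⟩ := hxs
    have habs : |t| ≤ 1 := abs_le.2 ⟨by linarith [ht.1], ht.2⟩
    constructor
    · simp only [Prod.fst_add, Prod.smul_fst, Prod.fst_sub, smul_eq_mul, add_sub_cancel_left,
        abs_mul]
      exact (mul_le_of_le_one_left (abs_nonneg _) habs).trans hdx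
    · simp only [Prod.snd_add, Prod.smul_snd, Prod.snd_sub, smul_eq_mul, add_sub_cancel_left,
        abs_mul]
      exact (mul_le_of_le_one_left (abs_nonneg _) habs).trans hdy
  have hint := (hw 0 0 (Nat.zero_le _)).2
  have hP : Tendsto (fun n => taylorPoly m (fun i j => partialXY i j (mollify (w 0 0) n) z₀) z₀ z)
      atTop (𝓝 (taylorPoly m (fun i j => w i j z₀) z₀ z)) := by
    simp only [taylorPoly, Finset.sum_apply, Pi.smul_apply, smul_eq_mul]
    refine tendsto_finsetSum _ fun p hp => Tendsto.mul_const _ ?_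
    have hpm : p.1 + p.2 < m := (Finset.mem_filter.1 hp).2
    refine (ht₀ p.1 p.2 hpm).congr' ?_
    filter_upwards [hball] with n hn
    exact (partialXY_mollify hint (hw _ _ hpm.le).1
      ((hn z₀ (left_mem_segment ℝ z₀ z)).trans hRΩ)).symm
  refine le_of_tendsto (ht.sub hP).abs ?_
  filter_upwards [hball] with n hn
  refine abs_sub_taylorPoly_le (convex_segment z₀ z) (left_mem_segment ℝ z₀ z) hx0 hy0
    (fun x hxs => (hdist x hxs).1) (fun x hxs => (hdist x hxs).2) (contDiff_mollify hint n)
    (fun i j hij x hxs => ?_) (right_mem_segment ℝ z₀ z)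
  rw [partialXY_mollify hint (hw i j hij.le).1 ((hn x hxs).trans hRΩ)]
  exact (mul_le_mul_of_nonneg_left
    (abs_mollify_le hR.measurableSet (hM0 i j) (hM i j hij) (hn x hxs)) (by positivity)).trans
    (hA i j hij)

/-- `v` is within `B` of a polynomial in `polyQ k`, almost everywhere on `T`. -/
def ApproxOn (k : ℕ) (T : Rect) (B : ℝ) (v : ℝ × ℝ → ℝ) : Prop :=
  ∃ p ∈ polyQ k, ∀ᵐ z ∂volume.restrict T.toSet, |v z - p z| ≤ B

theorem ApproxOn.add {k : ℕ} {T : Rect} {B B' : ℝ} {v v' : ℝ × ℝ → ℝ} (h : ApproxOn k T B v)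
    (h' : ApproxOn k T B' v') : ApproxOn k T (B + B') (v + v') := by
  obtain ⟨p, hp, hB⟩ := h
  obtain ⟨p', hp', hB'⟩ := h'
  refine ⟨p + p', Submodule.add_mem _ hp hp', ?_⟩
  filter_upwards [hB, hB'] with z hz hz'
  calc |(v + v') z - (p + p') z| = |(v z - p z) + (v' z - p' z)| := by
        simp only [Pi.add_apply]; congr 1; ring
    _ ≤ _ := (abs_add_le _ _).trans (add_le_add hz hz')

theorem ApproxOn.mono {k : ℕ} {T : Rect} {B B' : ℝ} {v : ℝ × ℝ → ℝ} (h : ApproxOn k T B v)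
    (hB : B ≤ B') : ApproxOn k T B' v := by
  obtain ⟨p, hp, h⟩ := h
  exact ⟨p, hp, h.mono fun z hz => hz.trans hB⟩

theorem ApproxOn.congr {k : ℕ} {T : Rect} {B : ℝ} {v v' : ℝ × ℝ → ℝ} (h : ApproxOn k T B v)
    (hv : v =ᵐ[volume.restrict T.toSet] v') : ApproxOn k T B v' := by
  obtain ⟨p, hp, h⟩ := h
  refine ⟨p, hp, ?_⟩
  filter_upwards [h, hv] with z hz hz'
  rwa [← hz']

theorem Rect.toSet_ae_eq (T : Rect) :
    (Ioo T.a T.b ×ˢ Ioo T.c T.d : Set (ℝ × ℝ)) =ᵐ[volume] T.toSet := by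
  rw [Measure.volume_eq_prod]
  exact Measure.set_prod_ae_eq Ioo_ae_eq_Icc Ioo_ae_eq_Icc

theorem Rect.restrict_toSet (T : Rect) :
    volume.restrict T.toSet = volume.restrict (Ioo T.a T.b ×ˢ Ioo T.c T.d : Set (ℝ × ℝ)) :=
  (Measure.restrict_congr_set T.toSet_ae_eq).symm

/-- The approximant is the Taylor polynomial at a point where the mollifications of all the
derivatives converge. Almost every point of the open rectangle qualifies, and its boundary is a null
set. -/
theorem approxOn_of_isWeakJet {k m : ℕ} (hm : m ≤ k + 1) {w : ℕ → ℕ → ℝ × ℝ → ℝ}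
    (hw : IsWeakJet m w) {T : Rect} (hx : T.a < T.b) (hy : T.c < T.d)
    (hTΩ : (Ioo T.a T.b ×ˢ Ioo T.c T.d : Set (ℝ × ℝ)) ⊆ unitSquare) {M : ℕ → ℕ → ℝ}
    (hM0 : ∀ i j, 0 ≤ M i j)
    (hM : ∀ i j, i + j = m → ∀ᵐ z ∂volume.restrict T.toSet, |w i j z| ≤ M i j) {A : ℝ}
    (hA : ∀ i j, i + j = m → T.hx ^ i * T.hy ^ j * M i j ≤ A) :
    ApproxOn k T (2 ^ m * A) (w 0 0) := by
  set R : Set (ℝ × ℝ) := Ioo T.a T.b ×ˢ Ioo T.c T.d with hRdef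
  have hR : IsOpen R := isOpen_Ioo.prod isOpen_Ioo
  have hRc : Convex ℝ R := (convex_Ioo _ _).prod (convex_Ioo _ _)
  have htend : ∀ᵐ z ∂volume.restrict R, ∀ i j, i + j ≤ m →
      Tendsto (fun n => mollify (w i j) n z) atTop (𝓝 (w i j z)) := by
    rw [ae_all_iff]; intro i
    rw [ae_all_iff]; intro j
    by_cases hij : i + j ≤ m
    · filter_upwards [ae_restrict_of_ae_restrict_of_subset hTΩ
        (ae_tendsto_mollify (hw i j hij).2)] with z hz _
      exact hz
    · exact Eventually.of_forall fun z h => absurd h hij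
  have hne : (ae (volume.restrict R)).NeBot := by
    rw [ae_neBot, Ne, Measure.restrict_eq_zero]
    refine (hR.measure_pos _ ⟨((T.a + T.b) / 2, (T.c + T.d) / 2), ?_⟩).ne'
    exact ⟨⟨by dsimp only; linarith, by dsimp only; linarith⟩,
      ⟨by dsimp only; linarith, by dsimp only; linarith⟩⟩
  have hmem := ae_restrict_mem (μ := (volume : Measure (ℝ × ℝ))) hR.measurableSet
  obtain ⟨z₀, hz₀, ht₀⟩ := (hmem.and htend).exists
  refine ⟨taylorPoly m (fun i j => w i j z₀) z₀, taylorPoly_mem_polyQ hm _ _, ?_⟩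
  rw [Rect.restrict_toSet] at hM ⊢
  filter_upwards [hmem, htend] with z hz ht
  have hd : ∀ {a b x y : ℝ}, x ∈ Ioo a b → y ∈ Ioo a b → |x - y| ≤ b - a := by
    intro a b x y h1 h2
    rw [abs_le]
    constructor <;> linarith [h1.1, h1.2, h2.1, h2.2]
  exact abs_sub_taylorPoly_weak_le hw hR hRc hTΩ hM0 hM hz₀ hz (fun i j hij => ht₀ i j hij.le)
    (ht 0 0 (Nat.zero_le _)) (sub_pos.2 hx) (sub_pos.2 hy) (hd hz.1 hz₀.1) (hd hz.2 hz₀.2) hA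

/-- A function with bounded weak gradient on `Ω` has a continuous representative. -/
theorem exists_continuous_ae_eq {w : ℕ → ℕ → ℝ × ℝ → ℝ} (hw : IsWeakJet 1 w) {M : ℝ} (hM0 : 0 ≤ M)
    (hM : ∀ i j, i + j = 1 → ∀ᵐ z ∂volume.restrict unitSquare, |w i j z| ≤ M) :
    ∃ g : ℝ × ℝ → ℝ, Continuous g ∧ w 0 0 =ᵐ[volume.restrict unitSquare] g := by
  have htend := ae_tendsto_mollify (hw 0 0 (by omega)).2
  have hc : Convex ℝ unitSquare := (convex_Ioo _ _).prod (convex_Ioo _ _)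
  set G : Set (ℝ × ℝ) := {z | z ∈ unitSquare ∧
    Tendsto (fun n => mollify (w 0 0) n z) atTop (𝓝 (w 0 0 z))} with hG
  -- Taylor's formula of order one between two points of the full-measure set `G`. The distance on
  -- the plane is the maximum of the coordinate distances, so it bounds both of them.
  have hLip : LipschitzOnWith (Real.toNNReal (2 * M)) (w 0 0) G := by
    refine LipschitzOnWith.of_dist_le_mul fun z hz z₀ hz₀ => ?_
    rcases eq_or_ne z z₀ with rfl | hne
    · simp
    have hd : 0 < dist z z₀ := dist_pos.2 hne
    have h := abs_sub_taylorPoly_weak_le hw isOpen_unitSquare hc subset_rfl (fun _ _ => hM0) hM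
      hz₀.1 hz.1 (fun i j hij => by
        obtain rfl : i = 0 := by omega
        obtain rfl : j = 0 := by omega
        exact hz₀.2) hz.2 hd hd (le_max_left _ _) (le_max_right _ _) (A := dist z z₀ * M)
      (fun i j hij => le_of_eq (by rw [← pow_add, hij, pow_one]))
    have e : taylorPoly 1 (fun i j => w i j z₀) z₀ z = w 0 0 z₀ := by
      simp [taylorPoly, taylorMonomial, Finset.filter_true_of_mem]
    rw [e, pow_one] at h
    rw [Real.dist_eq, Real.coe_toNNReal _ (by positivity)]
    linarith
  obtain ⟨g, hg, hgw⟩ := hLip.extend_real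
  refine ⟨g, hg.continuous, ?_⟩
  filter_upwards [htend, ae_restrict_mem measurableSet_unitSquare] with z hz hzm
  exact hgw ⟨hzm, hz⟩

/-! ### Traces and norms of the projection error -/

theorem volume_ball_inter_rect_pos {T : Rect} (hx : T.a < T.b) (hy : T.c < T.d) {z : ℝ × ℝ}
    (hz : z ∈ T.toSet) {r : ℝ} (hr : 0 < r) : 0 < volume (Metric.ball z r ∩ T.toSet) := by
  have hcl : z ∈ closure (Ioo T.a T.b ×ˢ Ioo T.c T.d) := by
    rw [closure_prod_eq, closure_Ioo hx.ne, closure_Ioo hy.ne]; exact hz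
  obtain ⟨y, hyR, hyz⟩ := Metric.mem_closure_iff.1 hcl r hr
  have hop : IsOpen (Metric.ball z r ∩ Ioo T.a T.b ×ˢ Ioo T.c T.d) :=
    Metric.isOpen_ball.inter (isOpen_Ioo.prod isOpen_Ioo)
  refine (hop.measure_pos volume ⟨y, by rwa [Metric.mem_ball, dist_comm], hyR⟩).trans_le
    (measure_mono (inter_subset_inter_right _ (prod_mono Ioo_subset_Icc_self Ioo_subset_Icc_self)))

/-- The trace of a bounded function with a continuous representative obeys the same bound. -/
theorem abs_trace_le {T : Rect} (hx : T.a < T.b) (hy : T.c < T.d) {e g : ℝ × ℝ → ℝ}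
    (hg : Continuous g) (heg : e =ᵐ[volume.restrict T.toSet] g) {B : ℝ}
    (hB : ∀ᵐ z ∂volume.restrict T.toSet, |e z| ≤ B) {z : ℝ × ℝ} (hz : z ∈ T.toSet) :
    |trace T e z| ≤ B := by
  have hpos := fun r (hr : (0 : ℝ) < r) => volume_ball_inter_rect_pos hx hy hz hr
  have hfin : ∀ r : ℝ, volume (Metric.ball z r ∩ T.toSet) ≠ ⊤ := fun r =>
    ((measure_mono inter_subset_right).trans_lt T.isCompact_toSet.measure_lt_top).ne
  have hTm : MeasurableSet T.toSet := T.isCompact_toSet.measurableSet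
  have hm : ∀ r : ℝ, MeasurableSet (Metric.ball z r ∩ T.toSet) := fun r =>
    Metric.isOpen_ball.measurableSet.inter hTm
  have hae : ∀ r : ℝ, e =ᵐ[volume.restrict (Metric.ball z r ∩ T.toSet)] g := fun r =>
    ae_restrict_of_ae_restrict_of_subset inter_subset_right heg
  have havg : ∀ r : ℝ, ⨍ w in Metric.ball z r ∩ T.toSet, e w
      = ⨍ w in Metric.ball z r ∩ T.toSet, g w := fun r => average_congr (hae r)
  have hgint : ∀ r : ℝ, IntegrableOn g (Metric.ball z r ∩ T.toSet) := fun r =>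
    (hg.continuousOn.integrableOn_compact T.isCompact_toSet).mono_set inter_subset_right
  have hlim : Tendsto (fun r => ⨍ w in Metric.ball z r ∩ T.toSet, e w) (𝓝[>] (0 : ℝ)) (𝓝 (g z)) := by
    simp only [havg]
    rw [Metric.tendsto_nhds]
    intro η hη
    obtain ⟨δ, hδ, hδg⟩ := Metric.continuousAt_iff.1 hg.continuousAt (η / 2) (half_pos hη)
    filter_upwards [Ioo_mem_nhdsGT hδ] with r hr
    -- A mean value lies in every closed convex set containing the values. The same principle gives
    -- the bound by `B` below.
    have h1 := Convex.set_average_mem (convex_closedBall (g z) (η / 2)) Metric.isClosed_closedBall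
      (μ := volume) (t := Metric.ball z r ∩ T.toSet) (f := g) (hpos r hr.1).ne' (hfin r)
      ((ae_restrict_iff' (hm r)).2 (Eventually.of_forall fun w hw =>
        (hδg ((Metric.mem_ball.1 hw.1).trans hr.2)).le)) (hgint r)
    exact (Metric.mem_closedBall.1 h1).trans_lt (half_lt_self hη)
  have htr : trace T e z = g z := hlim.limUnder_eq
  rw [htr]
  refine le_of_tendsto (htr ▸ hlim).abs ?_ |>.trans_eq' (by rw [htr])
  filter_upwards [self_mem_nhdsWithin] with r hr
  rw [havg]
  have h1 := Convex.set_average_mem (convex_closedBall (0 : ℝ) B) Metric.isClosed_closedBall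
    (μ := volume) (t := Metric.ball z r ∩ T.toSet) (f := g) (hpos r hr).ne' (hfin r)
    (by
      filter_upwards [hae r, ae_restrict_of_ae_restrict_of_subset inter_subset_right hB] with w h h'
      rw [mem_closedBall_zero_iff, ← h]; exact h') (hgint r)
  simpa using h1

theorem lintegral_Icc_enorm_sq_le {a b : ℝ} {f : ℝ → ℝ} {B : ℝ}
    (h : ∀ x ∈ Icc a b, |f x| ≤ B) :
    ∫⁻ x in Icc a b, ‖f x‖ₑ ^ 2 ≤ ENNReal.ofReal ((b - a) * B ^ 2) := by
  calc ∫⁻ x in Icc a b, ‖f x‖ₑ ^ 2 ≤ ∫⁻ _ in Icc a b, ENNReal.ofReal (B ^ 2) := by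
        refine setLIntegral_mono' measurableSet_Icc fun x hx => ?_
        rw [← ofReal_norm, ← ENNReal.ofReal_pow (norm_nonneg _)]
        exact ENNReal.ofReal_le_ofReal (pow_le_pow_left₀ (norm_nonneg _) (h x hx) 2)
    _ = _ := by
        rw [setLIntegral_const, Real.volume_Icc, ← ENNReal.ofReal_mul (sq_nonneg _), mul_comm]

theorem edgeNormSqX_le {T : Rect} (hx : T.a < T.b) (hy : T.c < T.d) {e : ℝ × ℝ → ℝ} {B : ℝ}
    (h : ∀ z ∈ T.toSet, |trace T e z| ≤ B) :
    edgeNormSqX T e ≤ ENNReal.ofReal (2 * T.hx * B ^ 2) := by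
  have h1 := lintegral_Icc_enorm_sq_le (f := fun x => trace T e (x, T.c)) fun x hx' =>
    h _ ⟨hx', left_mem_Icc.2 hy.le⟩
  have h2 := lintegral_Icc_enorm_sq_le (f := fun x => trace T e (x, T.d)) fun x hx' =>
    h _ ⟨hx', right_mem_Icc.2 hy.le⟩
  refine (add_le_add h1 h2).trans_eq ?_
  have := mul_nonneg (sub_nonneg.2 hx.le) (sq_nonneg B)
  rw [← ENNReal.ofReal_add this this, Rect.hx]
  congr 1; ring

theorem edgeNormSqY_le {T : Rect} (hx : T.a < T.b) (hy : T.c < T.d) {e : ℝ × ℝ → ℝ} {B : ℝ}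
    (h : ∀ z ∈ T.toSet, |trace T e z| ≤ B) :
    edgeNormSqY T e ≤ ENNReal.ofReal (2 * T.hy * B ^ 2) := by
  have h1 := lintegral_Icc_enorm_sq_le (f := fun y => trace T e (T.a, y)) fun x hx' =>
    h _ ⟨left_mem_Icc.2 hx.le, hx'⟩
  have h2 := lintegral_Icc_enorm_sq_le (f := fun y => trace T e (T.b, y)) fun x hx' =>
    h _ ⟨right_mem_Icc.2 hx.le, hx'⟩
  refine (add_le_add h1 h2).trans_eq ?_
  have := mul_nonneg (sub_nonneg.2 hy.le) (sq_nonneg B)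
  rw [← ENNReal.ofReal_add this this, Rect.hy]
  congr 1; ring

theorem normSq_le {T : Rect} (hx : T.a < T.b) (hy : T.c < T.d) {e : ℝ × ℝ → ℝ} {B : ℝ}
    (h : ∀ᵐ z ∂volume.restrict T.toSet, |e z| ≤ B) :
    normSq T e ≤ ENNReal.ofReal (T.hx * T.hy * B ^ 2) := by
  calc ∫⁻ z in T.toSet, ‖e z‖ₑ ^ 2 ≤ ∫⁻ _ in T.toSet, ENNReal.ofReal (B ^ 2) := by
        refine lintegral_mono_ae ?_
        filter_upwards [h] with z hz
        rw [← ofReal_norm, ← ENNReal.ofReal_pow (norm_nonneg _)]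
        exact ENNReal.ofReal_le_ofReal (pow_le_pow_left₀ (norm_nonneg _) hz 2)
    _ = _ := by
        have hv : volume T.toSet = ENNReal.ofReal (T.hx * T.hy) := by
          rw [← Rect.measureReal_toSet hx.le hy.le, ofReal_measureReal
            T.isCompact_toSet.measure_lt_top.ne]
        rw [setLIntegral_const, hv, ← ENNReal.ofReal_mul (sq_nonneg _), mul_comm]

/-- The local projection error of a function with a continuous representative is controlled in the
maximum norm, up to the boundary, by the best approximation error. -/
theorem exists_projErr_bounds (k : ℕ) : ∃ C : ℝ, 0 < C ∧ ∀ T : Rect, T.a < T.b → T.c < T.d →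
    ∀ (v g : ℝ × ℝ → ℝ) (B : ℝ), Continuous g → v =ᵐ[volume.restrict T.toSet] g →
      ApproxOn k T B v →
      (∀ᵐ z ∂volume.restrict T.toSet, |projErr k T v z| ≤ C * B) ∧
      ∀ z ∈ T.toSet, |trace T (projErr k T v) z| ≤ C * B := by
  obtain ⟨C, hC, h⟩ := exists_projErr_bound k
  refine ⟨C, hC, fun T hx hy v g B hg hvg ⟨p, hp, hB⟩ => ?_⟩
  have hv : IntegrableOn v T.toSet :=
    (hg.continuousOn.integrableOn_compact T.isCompact_toSet).congr hvg.symm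
  have h1 := h T hx hy v p B hv hp hB
  have hq := (l2Proj_spec (k := k) hx hy hv).1
  refine ⟨h1, fun z hz => abs_trace_le hx hy (hg.sub (polyQ_continuous hq)) ?_ h1 hz⟩
  filter_upwards [hvg] with w hw
  rw [projErr, hw, Pi.sub_apply]

/-! ### The one-dimensional mesh -/

/-- The argument of the logarithm in `layerPoint`. -/
noncomputable def layerArg (ε : ℝ) (N i : ℕ) : ℝ := 1 - 2 * (1 - ε) * i / N

theorem layerArg_succ (ε : ℝ) (N i : ℕ) :
    layerArg ε N i = layerArg ε N (i + 1) + 2 * (1 - ε) / N := by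
  simp only [layerArg]; push_cast; ring

theorem layerArg_half {ε : ℝ} {N n : ℕ} (hn : N = n + n) (hn0 : 0 < n) : layerArg ε N n = ε := by
  have : (n : ℝ) ≠ 0 := by positivity
  simp only [layerArg, hn]; push_cast; field_simp; ring

theorem layerArg_anti {ε : ℝ} (hε : ε ≤ 1) {N i j : ℕ} (hij : i ≤ j) :
    layerArg ε N j ≤ layerArg ε N i := by
  have h1 : (i : ℝ) ≤ j := by exact_mod_cast hij
  have h2 : 0 ≤ 2 * (1 - ε) := by linarith
  simp only [layerArg]
  gcongr

theorem layerArg_le_one {ε : ℝ} (hε : ε ≤ 1) (N i : ℕ) : layerArg ε N i ≤ 1 := by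
  have h := layerArg_anti hε (N := N) (Nat.zero_le i)
  simpa [layerArg] using h

/-- At the mesh point the exponential equals `layerArg ε N i ^ σ`, and a base of at most one turns
`σ ≥ k + 1` into the bound. -/
theorem exp_neg_le_layerArg_pow {k N i : ℕ} {σ ε β x : ℝ} (hσ : (k : ℝ) + 1 ≤ σ) (hβ : 0 < β)
    (hε : 0 < ε) (hε1 : ε ≤ 1) (ht : 0 < layerArg ε N i) (hx : layerPoint σ ε β N i ≤ x) :
    Real.exp (-(β * x / ε)) ≤ layerArg ε N i ^ (k + 1) := by
  have hlog : Real.log (layerArg ε N i) ≤ 0 := Real.log_nonpos ht.le (layerArg_le_one hε1 N i)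
  rw [← Real.exp_log ht, ← Real.exp_nat_mul, Real.exp_le_exp]
  have h1 : β * layerPoint σ ε β N i / ε = -(σ * Real.log (layerArg ε N i)) := by
    rw [layerPoint, ← layerArg]; field_simp
  have h2 : β * layerPoint σ ε β N i / ε ≤ β * x / ε := by gcongr
  have h3 : σ * Real.log (layerArg ε N i) ≤ (k + 1) * Real.log (layerArg ε N i) :=
    mul_le_mul_of_nonpos_right hσ hlog
  push_cast
  linarith

/-- The properties of a mesh interval `[a,b]` with index `i` on which the error analysis rests: `τ`
controls the layer function on the interval. -/
structure MeshInterval (k : ℕ) (β K ε : ℝ) (N i : ℕ) (a b τ : ℝ) : Prop where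
  nonneg : 0 ≤ a
  le_one : b ≤ 1
  lt : a < b
  width_le : (b - a) * N ≤ K
  le_width : ε ≤ K * N * (b - a)
  inv_le : (N : ℝ)⁻¹ ≤ τ
  tau_le : τ ≤ 1
  exp_le : ∀ x, a ≤ x → Real.exp (-(β * x / ε)) ≤ K * τ ^ (k + 1)
  fine : i + 1 < N / 2 → (b - a) * (N * τ) ≤ K * ε
  coarse : N / 2 ≤ i + 1 → τ = (N : ℝ)⁻¹

/-- The width is `σ * ε / β * log ((t + d) / t)` with step `d = 2 * (1 - ε) / N`. The logarithm lies
between `d / (t + d) ≥ d` and `d / t`, and `d * N` lies between `1` and `2`. -/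
theorem layerPoint_sub {σ ε β : ℝ} {N i : ℕ} (hσ : 0 < σ) (hβ : 0 < β) (hε : 0 < ε) (hε1 : ε ≤ 1 / 4)
    (hN : 0 < N) (ht : 0 < layerArg ε N (i + 1)) :
    (layerPoint σ ε β N (i + 1) - layerPoint σ ε β N i) * (N * layerArg ε N (i + 1))
        ≤ 2 * (σ / β) * ε ∧
      σ / β * ε ≤ N * (layerPoint σ ε β N (i + 1) - layerPoint σ ε β N i) := by
  set t := layerArg ε N (i + 1) with htdef
  have hN' : (0 : ℝ) < N := by exact_mod_cast hN
  set d := 2 * (1 - ε) / N with hd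
  have hd0 : 0 < d := div_pos (by linarith) hN'
  have hdN : d * N = 2 * (1 - ε) := by rw [hd]; field_simp
  have hs : layerArg ε N i = t + d := layerArg_succ ε N i
  have hs0 : 0 < t + d := by linarith
  have hs1 : t + d ≤ 1 := hs ▸ layerArg_le_one (by linarith) N i
  have e : layerPoint σ ε β N (i + 1) - layerPoint σ ε β N i
      = σ * ε / β * Real.log ((t + d) / t) := by
    rw [layerPoint, layerPoint, ← layerArg, ← layerArg, hs, ← htdef,
      Real.log_div hs0.ne' ht.ne']; ring
  have hl1 : Real.log ((t + d) / t) ≤ d / t := by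
    have h := Real.log_le_sub_one_of_pos (div_pos hs0 ht)
    have : (t + d) / t - 1 = d / t := by field_simp; ring
    linarith
  have hl2 : d ≤ Real.log ((t + d) / t) := by
    have h := Real.one_sub_inv_le_log_of_pos (div_pos hs0 ht)
    have h1 : 1 - ((t + d) / t)⁻¹ = d / (t + d) := by field_simp; ring
    have h2 : d ≤ d / (t + d) := by rw [le_div_iff₀ hs0]; nlinarith
    linarith
  have hc : 0 < σ * ε / β := by positivity
  rw [e]
  constructor
  · calc σ * ε / β * Real.log ((t + d) / t) * (N * t) ≤ σ * ε / β * (d / t) * (N * t) := by gcongr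
      _ = σ * ε / β * (d * N) := by field_simp
      _ ≤ σ * ε / β * 2 := by rw [hdN]; gcongr; linarith
      _ = _ := by ring
  · calc σ / β * ε = σ * ε / β * 1 := by ring
      _ ≤ σ * ε / β * (d * N) := by rw [hdN]; gcongr; linarith
      _ ≤ σ * ε / β * (Real.log ((t + d) / t) * N) := by gcongr
      _ = _ := by ring

/-- `τ` is `layerArg ε N i` on the graded intervals except the last one, and `N⁻¹` from there on.
The last graded interval counts as coarse because the logarithm's argument drops to `ε` at its right
end, so its values at the two ends are not comparable. -/
theorem exists_meshInterval (k : ℕ) {σ β : ℝ} (hσ : (k : ℝ) + 1 ≤ σ) (hβ : 0 < β) :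
    ∃ K : ℝ, 1 ≤ K ∧ ∀ (N : ℕ) (ε : ℝ), 4 ≤ N → Even N → 0 < ε → ε ≤ (N : ℝ)⁻¹ →
      meshPoint σ ε β N (N / 2) ≤ 1 / 2 → ∀ i < N,
        ∃ τ, MeshInterval k β K ε N i (meshPoint σ ε β N i) (meshPoint σ ε β N (i + 1)) τ := by
  have hσ0 : 0 < σ := lt_of_lt_of_le (by positivity) hσ
  have hc : 0 < σ / β := by positivity
  have hc' : 0 < β / σ := by positivity
  have h3 : (0 : ℝ) < 3 ^ (k + 1) := by positivity
  -- In turn: the upper and lower bounds for graded widths, the layer on the last graded interval,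
  -- and the width of the equidistant intervals.
  refine ⟨4 * (σ / β) + β / σ + 3 ^ (k + 1) + 2, by linarith, ?_⟩
  set K := 4 * (σ / β) + β / σ + 3 ^ (k + 1) + 2 with hK
  intro N ε hN4 hNe hε hεN hhalf i hi
  obtain ⟨n, hn⟩ := hNe
  have hn2 : N / 2 = n := by omega
  have hn0 : 0 < n := by omega
  have hN' : (4 : ℝ) ≤ N := by exact_mod_cast hN4
  have hN0 : (0 : ℝ) < N := by linarith
  have hNn : (N : ℝ) = 2 * n := by rw [hn]; push_cast; ring
  have hNinv : (N : ℝ)⁻¹ ≤ 1 / 4 := by rw [inv_eq_one_div]; gcongr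
  have hε4 : ε ≤ 1 / 4 := hεN.trans hNinv
  have hε1 : ε ≤ 1 := by linarith
  have hhalfArg : layerArg ε N n = ε := layerArg_half hn hn0
  have hd1 : (N : ℝ)⁻¹ ≤ 2 * (1 - ε) / N := by
    rw [inv_eq_one_div]; gcongr; linarith
  have hd2 : 2 * (1 - ε) / N ≤ 2 * (N : ℝ)⁻¹ := by
    rw [← div_eq_mul_inv]; gcongr; linarith
  have hxn : meshPoint σ ε β N n = layerPoint σ ε β N n := by simp [meshPoint, hn2]
  have hpt0 : ∀ j ≤ n, 0 ≤ layerPoint σ ε β N j := by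
    intro j hj
    have ht : 0 < layerArg ε N j := by
      have := layerArg_anti hε1 (N := N) hj; linarith
    rw [layerPoint, ← layerArg]
    exact mul_nonneg_of_nonpos_of_nonpos (neg_nonpos.2 (by positivity))
      (Real.log_nonpos ht.le (layerArg_le_one hε1 N j))
  rw [hn2, hxn] at hhalf
  have hx0 := hpt0 n le_rfl
  rcases lt_or_ge i n with hin | hin
  · have e1 : meshPoint σ ε β N i = layerPoint σ ε β N i := by
      rw [meshPoint, if_pos (by omega)]
    have e2 : meshPoint σ ε β N (i + 1) = layerPoint σ ε β N (i + 1) := by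
      rw [meshPoint, if_pos (by omega)]
    rw [e1, e2]
    have htε : ε ≤ layerArg ε N (i + 1) := by
      exact hhalfArg.symm.le.trans (layerArg_anti hε1 hin)
    have ht : 0 < layerArg ε N (i + 1) := by linarith
    have hs := layerArg_succ ε N i
    have hs0 : 0 < layerArg ε N i := by
      have : 0 < (N : ℝ)⁻¹ := by positivity
      linarith
    obtain ⟨hup, hlow⟩ := layerPoint_sub (i := i) hσ0 hβ hε hε4 (by omega) ht
    set h := layerPoint σ ε β N (i + 1) - layerPoint σ ε β N i with hh
    have hpos : 0 < h := by
      have : 0 < σ / β * ε := by positivity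
      exact pos_of_mul_pos_right (lt_of_lt_of_le this hlow) hN0.le
    have hle1 : layerPoint σ ε β N (i + 1) ≤ 1 := by
      have : layerPoint σ ε β N (i + 1) ≤ layerPoint σ ε β N n := by
        rw [layerPoint, layerPoint, ← layerArg, ← layerArg, neg_mul, neg_mul, neg_le_neg_iff]
        exact mul_le_mul_of_nonneg_left (Real.log_le_log (by rw [hhalfArg]; exact hε)
          (layerArg_anti hε1 hin)) (by positivity)
      linarith
    -- The argument of the logarithm is at least `ε` up to the transition point, so `ε` cancels from
    -- the upper bound.
    have hw : h * N ≤ K := by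
      have : h * N * ε ≤ 2 * (σ / β) * ε := by
        refine le_trans ?_ hup
        rw [mul_assoc]
        gcongr
      have := le_of_mul_le_mul_right this hε
      linarith
    have hlw : ε ≤ K * N * h := by
      calc ε = β / σ * (σ / β * ε) := by field_simp
        _ ≤ β / σ * (N * h) := by gcongr
        _ ≤ K * (N * h) := by gcongr; linarith
        _ = _ := by ring
    have hexp : ∀ x, layerPoint σ ε β N i ≤ x →
        Real.exp (-(β * x / ε)) ≤ layerArg ε N i ^ (k + 1) := fun x hx =>
      exp_neg_le_layerArg_pow hσ hβ hε hε1 hs0 hx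
    rcases lt_or_ge (i + 1) n with hin' | hin'
    · have hgt : 2 * (1 - ε) / N ≤ layerArg ε N (i + 1) := by
        have h1 := layerArg_anti hε1 (N := N) (show i + 1 + 1 ≤ n from hin')
        rw [layerArg_succ ε N (i + 1)]
        linarith
      refine ⟨layerArg ε N i, hpt0 i hin.le, hle1, by linarith, hw, hlw, by linarith,
        layerArg_le_one hε1 N i, fun x hx => (hexp x hx).trans ?_, fun _ => ?_, fun h' => by omega⟩
      · exact le_mul_of_one_le_left (by positivity) (by linarith)
      · calc h * (N * layerArg ε N i) ≤ h * (N * (2 * layerArg ε N (i + 1))) := by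
              gcongr; linarith
          _ = 2 * (h * (N * layerArg ε N (i + 1))) := by ring
          _ ≤ 2 * (2 * (σ / β) * ε) := by gcongr
          _ = 4 * (σ / β) * ε := by ring
          _ ≤ K * ε := by gcongr; linarith
    · refine ⟨(N : ℝ)⁻¹, hpt0 i hin.le, hle1, by linarith, hw, hlw, le_rfl, by linarith,
        fun x hx => (hexp x hx).trans ?_, fun h' => by omega, fun _ => rfl⟩
      have hin'' : i + 1 = n := by omega
      have hti : layerArg ε N i ≤ 3 * (N : ℝ)⁻¹ := by
        rw [hs, hin'', hhalfArg]; linarith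
      calc layerArg ε N i ^ (k + 1) ≤ (3 * (N : ℝ)⁻¹) ^ (k + 1) := by gcongr
        _ = 3 ^ (k + 1) * (N : ℝ)⁻¹ ^ (k + 1) := mul_pow _ _ _
        _ ≤ K * (N : ℝ)⁻¹ ^ (k + 1) := by gcongr; linarith
  -- The two branches of `meshPoint` agree at `j = n`, since `N = 2 * n`.
  · have hform : ∀ j, n ≤ j → meshPoint σ ε β N j
        = 1 - (1 - layerPoint σ ε β N n) * (2 * ((N : ℝ) - j) / N) := by
      intro j hj
      rw [meshPoint, hn2]
      split_ifs with h
      · obtain rfl : j = n := by omega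
        rw [hNn]; field_simp; ring
      · rfl
    have hdiff : meshPoint σ ε β N (i + 1) - meshPoint σ ε β N i
        = (1 - layerPoint σ ε β N n) * (2 / N) := by
      rw [hform i hin, hform (i + 1) (by omega)]; push_cast; ring
    have hge : layerPoint σ ε β N n ≤ meshPoint σ ε β N i := by
      rw [hform i hin]
      have hfrac : 2 * ((N : ℝ) - i) / N ≤ 1 := by
        rw [div_le_one hN0]
        have : (n : ℝ) ≤ i := by exact_mod_cast hin
        linarith
      nlinarith
    have hiN : ((i + 1 : ℕ) : ℝ) ≤ N := by exact_mod_cast hi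
    have hle1 : meshPoint σ ε β N (i + 1) ≤ 1 := by
      rw [hform (i + 1) (by omega)]
      have h1 : 0 ≤ 2 * ((N : ℝ) - (i + 1 : ℕ)) / N := by
        apply div_nonneg _ hN0.le; linarith
      have h2 : 0 ≤ 1 - layerPoint σ ε β N n := by linarith
      nlinarith [mul_nonneg h2 h1]
    have hwN : (meshPoint σ ε β N (i + 1) - meshPoint σ ε β N i) * N
        = 2 * (1 - layerPoint σ ε β N n) := by
      rw [hdiff]; field_simp
    refine ⟨(N : ℝ)⁻¹, hx0.trans hge, hle1, ?_, ?_, ?_, le_rfl, by linarith, fun x hx => ?_,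
      fun h' => by omega, fun _ => rfl⟩
    · have : 0 < (1 - layerPoint σ ε β N n) * (2 / N) := mul_pos (by linarith) (by positivity)
      linarith
    · linarith
    · rw [mul_assoc, mul_comm (N : ℝ), hwN]
      have : 1 ≤ K * (2 * (1 - layerPoint σ ε β N n)) := by nlinarith
      linarith
    · have h1 := exp_neg_le_layerArg_pow (k := k) (N := N) (i := n) hσ hβ hε hε1
        (by rw [hhalfArg]; exact hε) (hge.trans hx)
      rw [hhalfArg] at h1
      calc _ ≤ ε ^ (k + 1) := h1
        _ ≤ (N : ℝ)⁻¹ ^ (k + 1) := by gcongr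
        _ ≤ K * (N : ℝ)⁻¹ ^ (k + 1) := le_mul_of_one_le_left (by positivity) (by linarith)

/-! ### Local estimates for the components of the solution -/

/-- The jet of a component, with a continuous representative for all but the highest derivatives. -/
theorem exists_regular_jet {k : ℕ} {C : ℝ} {W : ℕ → ℕ → ℝ × ℝ → ℝ} {M : ℕ → ℕ → ℝ} {v : ℝ × ℝ → ℝ}
    (h : HasDerivBounds (k + 1) C W v)
    (hW : ∀ i j, ∀ z ∈ unitSquare, 0 ≤ W i j z ∧ W i j z ≤ M i j) :
    ∃ w : ℕ → ℕ → ℝ × ℝ → ℝ, v =ᵐ[volume.restrict unitSquare] w 0 0 ∧ IsWeakJet (k + 1) w ∧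
      (∀ i j, i + j ≤ k + 1 → ∀ᵐ z ∂volume.restrict unitSquare, |w i j z| ≤ |C| * W i j z) ∧
      ∀ p q, p + q ≤ k → ∃ g : ℝ × ℝ → ℝ, Continuous g ∧ w p q =ᵐ[volume.restrict unitSquare] g := by
  -- The sign of `C` is not prescribed, while later estimates need a nonnegative constant.
  have hle : ∀ i j, ∀ z ∈ unitSquare, C * W i j z ≤ |C| * W i j z := fun i j z hz =>
    mul_le_mul_of_nonneg_right (le_abs_self C) (hW i j z hz).1
  have hle' : ∀ i j, ∀ z ∈ unitSquare, |C| * W i j z ≤ |C| * M i j := fun i j z hz =>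
    mul_le_mul_of_nonneg_left (hW i j z hz).2 (abs_nonneg C)
  obtain ⟨w, hvw, hw, hb⟩ := exists_isWeakJet h fun i j _ =>
    ⟨|C| * M i j, fun z hz => (hle i j z hz).trans (hle' i j z hz)⟩
  have hmem := ae_restrict_mem (μ := (volume : Measure (ℝ × ℝ))) measurableSet_unitSquare
  refine ⟨w, hvw, hw, fun i j hij => ?_, fun p q hpq => ?_⟩
  · filter_upwards [hb i j hij, hmem] with z hz hzm
    exact hz.trans (hle i j z hzm)
  · have hjet : IsWeakJet 1 (fun i j => w (p + i) (q + j)) :=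
      IsWeakJet.shift fun i j hij => hw i j (by omega)
    refine exists_continuous_ae_eq hjet
      (M := |C| * max |M (p + 1) q| |M p (q + 1)|) (by positivity) fun i j hij => ?_
    filter_upwards [hb (p + i) (q + j) (by omega), hmem] with z hz hzm
    refine (hz.trans (hle _ _ z hzm)).trans ((hle' _ _ z hzm).trans ?_)
    refine mul_le_mul_of_nonneg_left ?_ (abs_nonneg C)
    rcases i with _ | i
    · obtain rfl : j = 1 := by omega
      exact (le_abs_self _).trans (le_max_right _ _)
    · obtain rfl : i = 0 := by omega
      obtain rfl : j = 0 := by omega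
      exact (le_abs_self _).trans (le_max_left _ _)

/-- Here `sx` and `sy` are the costs of one derivative, and `L * τ ^ (k + 1)` is the size of the
layer. On fine cells each of the `m` factors `width * cost` of the Taylor remainder is at most `K /
(N * τ)`, leaving `τ ^ (p + q)`. If `τ = N⁻¹`, the a priori bound already has this form and the zero
polynomial suffices. -/
theorem approxOn_component {k m p q N : ℕ} (hm : m + p + q = k + 1) {w : ℕ → ℕ → ℝ × ℝ → ℝ}
    (hw : IsWeakJet (k + 1) w) {T : Rect} (hx : T.a < T.b) (hy : T.c < T.d)
    (hTΩ : (Ioo T.a T.b ×ˢ Ioo T.c T.d : Set (ℝ × ℝ)) ⊆ unitSquare) {C K L sx sy τ : ℝ}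
    (hC : 0 ≤ C) (hK : 1 ≤ K) (hL : 0 ≤ L) (hsx : 0 ≤ sx) (hsy : 0 ≤ sy) (hτ : 0 < τ) (hN : 0 < N)
    (hb : ∀ i j, i + j ≤ k + 1 →
      ∀ᵐ z ∂volume.restrict T.toSet, |w i j z| ≤ C * (sx ^ i * sy ^ j * (L * τ ^ (k + 1))))
    (h : (T.hx * sx * (N * τ) ≤ K ∧ T.hy * sy * (N * τ) ≤ K) ∨ τ = (N : ℝ)⁻¹) :
    ApproxOn k T (2 ^ m * (K ^ m * (C * L * (sx ^ p * sy ^ q) * ((N : ℝ)⁻¹ ^ m * τ ^ (p + q)))))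
      (w p q) := by
  have hN' : (0 : ℝ) < N := by exact_mod_cast hN
  have hx' : 0 < T.hx := sub_pos.2 hx
  have hy' : 0 < T.hy := sub_pos.2 hy
  set G := C * L * (sx ^ p * sy ^ q) * ((N : ℝ)⁻¹ ^ m * τ ^ (p + q)) with hG
  have hG0 : 0 ≤ G := by positivity
  rcases h with ⟨h1, h2⟩ | h
  · have hjet : IsWeakJet m (fun i j => w (p + i) (q + j)) :=
      IsWeakJet.shift fun i j hij => hw i j (by omega)
    refine approxOn_of_isWeakJet (by omega) hjet hx hy hTΩ
      (M := fun i j => C * (sx ^ (p + i) * sy ^ (q + j) * (L * τ ^ (k + 1))))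
      (fun i j => by positivity) (fun i j hij => hb _ _ (by omega)) fun i j hij => ?_
    have e : T.hx ^ i * T.hy ^ j * (C * (sx ^ (p + i) * sy ^ (q + j) * (L * τ ^ (k + 1))))
        = (T.hx * sx * (N * τ)) ^ i * (T.hy * sy * (N * τ)) ^ j * G := by
      rw [hG, ← hm, ← hij]
      simp only [mul_pow, pow_add, inv_pow]
      field_simp
    rw [e]
    refine mul_le_mul_of_nonneg_right ?_ hG0
    rw [← hij, pow_add]
    gcongr
  · refine ⟨0, Submodule.zero_mem _, ?_⟩
    filter_upwards [hb p q (by omega)] with z hz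
    rw [Pi.zero_apply, sub_zero]
    refine hz.trans ?_
    have e : C * (sx ^ p * sy ^ q * (L * τ ^ (k + 1))) = G := by
      rw [hG, h, ← pow_add, ← hm]; ring
    rw [e, ← mul_assoc]
    refine le_mul_of_one_le_left hG0 ?_
    have h2 : (1 : ℝ) ≤ 2 ^ m := one_le_pow₀ (by norm_num)
    have h3 : 1 ≤ K ^ m := one_le_pow₀ hK
    nlinarith

/-- The jet `w` and its first derivatives can be approximated on `T`, with errors `A` and `A'`. -/
def JetApproxOn (k : ℕ) (T : Rect) (A A' : ℝ) (w : ℕ → ℕ → ℝ × ℝ → ℝ) : Prop :=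
  ApproxOn k T A (w 0 0) ∧ ApproxOn k T A' (w 1 0) ∧ ApproxOn k T A' (w 0 1)

theorem JetApproxOn.add {k : ℕ} {T : Rect} {A A' B B' : ℝ} {w w' : ℕ → ℕ → ℝ × ℝ → ℝ}
    (h : JetApproxOn k T A A' w) (h' : JetApproxOn k T B B' w') :
    JetApproxOn k T (A + B) (A' + B') (w + w') :=
  ⟨h.1.add h'.1, h.2.1.add h'.2.1, h.2.2.add h'.2.2⟩

/-- `Q` is a common majorant of `sx * τ` and `sy * τ`, so that all four components of `u` can share
the gradient bound with `Q = ε⁻¹ * (τx + τy)`. -/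
theorem jetApproxOn_component {k N : ℕ} {w : ℕ → ℕ → ℝ × ℝ → ℝ}
    (hw : IsWeakJet (k + 1) w) {T : Rect} (hx : T.a < T.b) (hy : T.c < T.d)
    (hTΩ : (Ioo T.a T.b ×ˢ Ioo T.c T.d : Set (ℝ × ℝ)) ⊆ unitSquare) {C K L sx sy τ Q : ℝ}
    (hC : 0 ≤ C) (hK : 1 ≤ K) (hL : 0 ≤ L) (hsx : 0 ≤ sx) (hsy : 0 ≤ sy) (hτ : 0 < τ) (hN : 0 < N)
    (hb : ∀ i j, i + j ≤ k + 1 →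
      ∀ᵐ z ∂volume.restrict T.toSet, |w i j z| ≤ C * (sx ^ i * sy ^ j * (L * τ ^ (k + 1))))
    (h : (T.hx * sx * (N * τ) ≤ K ∧ T.hy * sy * (N * τ) ≤ K) ∨ τ = (N : ℝ)⁻¹)
    (hQx : sx * τ ≤ Q) (hQy : sy * τ ≤ Q) :
    JetApproxOn k T ((2 * K) ^ (k + 1) * C * L * (N : ℝ)⁻¹ ^ (k + 1))
      ((2 * K) ^ (k + 1) * C * L * ((N : ℝ)⁻¹ ^ k * Q)) w := by
  have hp : (2 * K) ^ k ≤ (2 * K) ^ (k + 1) := pow_le_pow_right₀ (by linarith) (Nat.le_succ k)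
  have hQ : 0 ≤ Q := (mul_nonneg hsx hτ.le).trans hQx
  refine ⟨?_, ?_, ?_⟩
  · refine (approxOn_component (m := k + 1) (p := 0) (q := 0) rfl hw hx hy hTΩ hC hK hL hsx hsy hτ hN
      hb h).mono (le_of_eq ?_)
    rw [mul_pow]; ring
  · refine (approxOn_component (m := k) (p := 1) (q := 0) rfl hw hx hy hTΩ hC hK hL hsx hsy hτ hN
      hb h).mono ?_
    calc _ = (2 * K) ^ k * C * L * ((N : ℝ)⁻¹ ^ k * (sx * τ)) := by rw [mul_pow]; ring
      _ ≤ _ := by gcongr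
  · refine (approxOn_component (m := k) (p := 0) (q := 1) (by ring) hw hx hy hTΩ hC hK hL hsx hsy hτ
      hN hb h).mono ?_
    calc _ = (2 * K) ^ k * C * L * ((N : ℝ)⁻¹ ^ k * (sy * τ)) := by rw [mul_pow]; ring
      _ ≤ _ := by gcongr

theorem MeshInterval.mono {k N i : ℕ} {β K K' ε a b τ : ℝ} (h : MeshInterval k β K ε N i a b τ)
    (hK : K ≤ K') (hε : 0 ≤ ε) : MeshInterval k β K' ε N i a b τ := by
  have hτ : 0 ≤ τ := le_trans (by positivity) h.inv_le
  have hw : 0 ≤ b - a := sub_nonneg.2 h.lt.le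
  refine ⟨h.nonneg, h.le_one, h.lt, h.width_le.trans hK, h.le_width.trans ?_, h.inv_le, h.tau_le,
    fun x hx => (h.exp_le x hx).trans ?_, fun hi => (h.fine hi).trans ?_, h.coarse⟩ <;> gcongr

/-- A cell of the tensor-product mesh. -/
structure MeshCell (k : ℕ) (β₁ β₂ K ε : ℝ) (N i j : ℕ) (T : Rect) (τx τy : ℝ) : Prop where
  one_le : 1 ≤ K
  eps_pos : 0 < ε
  eps_le : ε ≤ (N : ℝ)⁻¹
  N_ge : 4 ≤ N
  fst : MeshInterval k β₁ K ε N i T.a T.b τx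
  snd : MeshInterval k β₂ K ε N j T.c T.d τy

/-! ### Approximation of the smooth part and of the layers on one mesh cell -/

namespace MeshCell

variable {k N i j : ℕ} {β₁ β₂ K ε τx τy : ℝ} {T : Rect}

theorem N_pos (h : MeshCell k β₁ β₂ K ε N i j T τx τy) : (0 : ℝ) < N := by
  have := h.N_ge
  exact_mod_cast (by omega : 0 < N)

theorem τx_pos (h : MeshCell k β₁ β₂ K ε N i j T τx τy) : 0 < τx :=
  (inv_pos.2 h.N_pos).trans_le h.fst.inv_le

theorem τy_pos (h : MeshCell k β₁ β₂ K ε N i j T τx τy) : 0 < τy :=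
  (inv_pos.2 h.N_pos).trans_le h.snd.inv_le

theorem hx_pos (h : MeshCell k β₁ β₂ K ε N i j T τx τy) : 0 < T.hx := sub_pos.2 h.fst.lt

theorem hy_pos (h : MeshCell k β₁ β₂ K ε N i j T τx τy) : 0 < T.hy := sub_pos.2 h.snd.lt

theorem subset (h : MeshCell k β₁ β₂ K ε N i j T τx τy) :
    (Ioo T.a T.b ×ˢ Ioo T.c T.d : Set (ℝ × ℝ)) ⊆ unitSquare :=
  Set.prod_mono (Ioo_subset_Ioo h.fst.nonneg h.fst.le_one) (Ioo_subset_Ioo h.snd.nonneg h.snd.le_one)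

theorem ae_restrict (h : MeshCell k β₁ β₂ K ε N i j T τx τy) {P : ℝ × ℝ → Prop}
    (hP : ∀ᵐ z ∂volume.restrict unitSquare, P z) : ∀ᵐ z ∂volume.restrict T.toSet, P z := by
  rw [Rect.restrict_toSet]
  exact ae_restrict_of_ae_restrict_of_subset h.subset hP

theorem ae_bound_of_weight_le (h : MeshCell k β₁ β₂ K ε N i j T τx τy) {W : ℕ → ℕ → ℝ × ℝ → ℝ}
    {w : ℕ → ℕ → ℝ × ℝ → ℝ} {C : ℝ} (hC : 0 ≤ C) {V : ℕ → ℕ → ℝ}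
    (hb : ∀ i j, i + j ≤ k + 1 → ∀ᵐ z ∂volume.restrict unitSquare, |w i j z| ≤ C * W i j z)
    (hW : ∀ i j, ∀ z ∈ T.toSet, W i j z ≤ V i j) :
    ∀ i j, i + j ≤ k + 1 → ∀ᵐ z ∂volume.restrict T.toSet, |w i j z| ≤ C * V i j := by
  intro i j hij
  filter_upwards [h.ae_restrict (hb i j hij), ae_restrict_mem T.isCompact_toSet.measurableSet]
    with z hz hzT
  exact hz.trans (mul_le_mul_of_nonneg_left (hW i j z hzT) hC)

variable {w : ℕ → ℕ → ℝ × ℝ → ℝ} {C : ℝ}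

theorem fine_or_coarse_x (h : MeshCell k β₁ β₂ K ε N i j T τx τy) :
    T.hx * ε⁻¹ * (N * τx) ≤ K ∨ τx = (N : ℝ)⁻¹ := by
  rcases lt_or_ge (i + 1) (N / 2) with hi | hi
  · left
    have := h.fst.fine hi
    rw [mul_right_comm, ← div_eq_mul_inv, div_le_iff₀ h.eps_pos]
    exact this
  · exact Or.inr (h.fst.coarse hi)

theorem fine_or_coarse_y (h : MeshCell k β₁ β₂ K ε N i j T τx τy) :
    T.hy * ε⁻¹ * (N * τy) ≤ K ∨ τy = (N : ℝ)⁻¹ := by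
  rcases lt_or_ge (j + 1) (N / 2) with hi | hi
  · left
    have := h.snd.fine hi
    rw [mul_right_comm, ← div_eq_mul_inv, div_le_iff₀ h.eps_pos]
    exact this
  · exact Or.inr (h.snd.coarse hi)

theorem width_mul_le {N : ℕ} {h K τ : ℝ} (hh : 0 ≤ h) (hw : h * N ≤ K) (hτ : τ ≤ 1) :
    h * 1 * (N * τ) ≤ K := by
  refine le_trans ?_ hw
  rw [mul_one]
  refine mul_le_mul_of_nonneg_left ?_ hh
  exact mul_le_of_le_one_right (by positivity) hτ

theorem jetApproxOn_smooth (h : MeshCell k β₁ β₂ K ε N i j T τx τy) (hw : IsWeakJet (k + 1) w)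
    (hC : 0 ≤ C)
    (hb : ∀ i j, i + j ≤ k + 1 → ∀ᵐ z ∂volume.restrict unitSquare, |w i j z| ≤ C * 1) :
    JetApproxOn k T ((2 * K) ^ (k + 1) * C * K ^ 2 * (N : ℝ)⁻¹ ^ (k + 1))
      ((2 * K) ^ (k + 1) * C * K ^ 2 * ((N : ℝ)⁻¹ ^ k * (ε⁻¹ * (τx + τy)))) w := by
  -- The smooth part is treated with `τ = 1` and unit derivative costs; `ε ≤ N⁻¹ ≤ τx` fits it under
  -- the layer bound. The factor `K ^ 2` only matches the corner layer.
  have hQ : 1 * 1 ≤ ε⁻¹ * (τx + τy) := by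
    rw [one_mul, ← div_eq_inv_mul, le_div_iff₀ h.eps_pos, one_mul]
    linarith [h.eps_le, h.fst.inv_le, h.τy_pos]
  have h1 : 1 ≤ K ^ 2 := one_le_pow₀ h.one_le
  refine jetApproxOn_component hw h.fst.lt h.snd.lt h.subset hC h.one_le (by positivity)
    zero_le_one zero_le_one one_pos (by have := h.N_ge; omega)
    (h.ae_bound_of_weight_le hC (W := fun _ _ _ => 1) hb fun i j z _ => ?_)
    (Or.inl ⟨width_mul_le h.hx_pos.le h.fst.width_le le_rfl,
      width_mul_le h.hy_pos.le h.snd.width_le le_rfl⟩) hQ hQ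
  simpa only [one_pow, one_mul, mul_one] using h1

theorem inv_eps_ge_one (h : MeshCell k β₁ β₂ K ε N i j T τx τy) : 1 ≤ ε⁻¹ := by
  have h1 : (1 : ℝ) ≤ N := by
    have := h.N_ge
    exact_mod_cast (by omega : 1 ≤ N)
  exact (one_le_inv₀ h.eps_pos).2 (h.eps_le.trans (inv_le_one_of_one_le₀ h1))

theorem le_sq (h : MeshCell k β₁ β₂ K ε N i j T τx τy) : K ≤ K ^ 2 := by
  nlinarith [h.one_le]

theorem jetApproxOn_layerY (h : MeshCell k β₁ β₂ K ε N i j T τx τy) (hw : IsWeakJet (k + 1) w)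
    (hC : 0 ≤ C)
    (hb : ∀ i j, i + j ≤ k + 1 → ∀ᵐ z ∂volume.restrict unitSquare,
      |w i j z| ≤ C * ((ε ^ j)⁻¹ * Real.exp (-(β₂ * z.2 / ε)))) :
    JetApproxOn k T ((2 * K) ^ (k + 1) * C * K ^ 2 * (N : ℝ)⁻¹ ^ (k + 1))
      ((2 * K) ^ (k + 1) * C * K ^ 2 * ((N : ℝ)⁻¹ ^ k * (ε⁻¹ * (τx + τy)))) w := by
  have hε := h.inv_eps_ge_one
  have hx := h.τx_pos
  have hy := h.τy_pos
  refine jetApproxOn_component hw h.fst.lt h.snd.lt h.subset hC h.one_le (by positivity)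
    (sx := 1) (sy := ε⁻¹) (τ := τy) zero_le_one (by positivity) h.τy_pos
    (by have := h.N_ge; omega)
    (h.ae_bound_of_weight_le hC (W := fun _ j z => (ε ^ j)⁻¹ * Real.exp (-(β₂ * z.2 / ε))) hb
      fun i j z hz => ?_) ?_ ?_ ?_
  · have h1 := h.snd.exp_le z.2 hz.2.1
    have h2 := h.le_sq
    have hεp := h.eps_pos
    rw [one_pow, one_mul, inv_pow]
    refine mul_le_mul_of_nonneg_left (h1.trans ?_) (by positivity)
    gcongr
  · rcases h.fine_or_coarse_y with h1 | h1
    · exact Or.inl ⟨width_mul_le h.hx_pos.le h.fst.width_le h.snd.tau_le, h1⟩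
    · exact Or.inr h1
  · exact mul_le_mul hε (by linarith) hy.le (by positivity)
  · gcongr; linarith

theorem jetApproxOn_layerX (h : MeshCell k β₁ β₂ K ε N i j T τx τy) (hw : IsWeakJet (k + 1) w)
    (hC : 0 ≤ C)
    (hb : ∀ i j, i + j ≤ k + 1 → ∀ᵐ z ∂volume.restrict unitSquare,
      |w i j z| ≤ C * ((ε ^ i)⁻¹ * Real.exp (-(β₁ * z.1 / ε)))) :
    JetApproxOn k T ((2 * K) ^ (k + 1) * C * K ^ 2 * (N : ℝ)⁻¹ ^ (k + 1))
      ((2 * K) ^ (k + 1) * C * K ^ 2 * ((N : ℝ)⁻¹ ^ k * (ε⁻¹ * (τx + τy)))) w := by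
  have hε := h.inv_eps_ge_one
  have hx := h.τx_pos
  have hy := h.τy_pos
  refine jetApproxOn_component hw h.fst.lt h.snd.lt h.subset hC h.one_le (by positivity)
    (sx := ε⁻¹) (sy := 1) (τ := τx) (by positivity) zero_le_one h.τx_pos
    (by have := h.N_ge; omega)
    (h.ae_bound_of_weight_le hC (W := fun i _ z => (ε ^ i)⁻¹ * Real.exp (-(β₁ * z.1 / ε))) hb
      fun i j z hz => ?_) ?_ ?_ ?_
  · have h1 := h.fst.exp_le z.1 hz.1.1
    have h2 := h.le_sq
    have hεp := h.eps_pos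
    rw [one_pow, mul_one, inv_pow]
    refine mul_le_mul_of_nonneg_left (h1.trans ?_) (by positivity)
    gcongr
  · rcases h.fine_or_coarse_x with h1 | h1
    · exact Or.inl ⟨h1, width_mul_le h.hy_pos.le h.snd.width_le h.fst.tau_le⟩
    · exact Or.inr h1
  · gcongr; linarith
  · exact mul_le_mul hε (by linarith) hx.le (by positivity)

theorem jetApproxOn_corner (h : MeshCell k β₁ β₂ K ε N i j T τx τy) (hw : IsWeakJet (k + 1) w)
    (hC : 0 ≤ C)
    (hb : ∀ i j, i + j ≤ k + 1 → ∀ᵐ z ∂volume.restrict unitSquare,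
      |w i j z| ≤ C * ((ε ^ (i + j))⁻¹ * Real.exp (-((β₁ * z.1 + β₂ * z.2) / ε)))) :
    JetApproxOn k T ((2 * K) ^ (k + 1) * C * K ^ 2 * (N : ℝ)⁻¹ ^ (k + 1))
      ((2 * K) ^ (k + 1) * C * K ^ 2 * ((N : ℝ)⁻¹ ^ k * (ε⁻¹ * (τx + τy)))) w := by
  have hε := h.inv_eps_ge_one
  have hx := h.τx_pos
  have hy := h.τy_pos
  have hx1 := h.fst.tau_le
  have hy1 := h.snd.tau_le
  have hεp := h.eps_pos
  have hK := h.one_le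
  have hexp : ∀ z ∈ T.toSet, Real.exp (-((β₁ * z.1 + β₂ * z.2) / ε))
      ≤ K ^ 2 * (τx * τy) ^ (k + 1) := by
    intro z hz
    have e : -((β₁ * z.1 + β₂ * z.2) / ε) = -(β₁ * z.1 / ε) + -(β₂ * z.2 / ε) := by ring
    rw [e, Real.exp_add]
    calc _ ≤ (K * τx ^ (k + 1)) * (K * τy ^ (k + 1)) :=
          mul_le_mul (h.fst.exp_le z.1 hz.1.1) (h.snd.exp_le z.2 hz.2.1) (Real.exp_pos _).le
            (by positivity)
      _ = _ := by rw [mul_pow]; ring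
  have hτxx : τx * τy ≤ τx := mul_le_of_le_one_right hx.le hy1
  have hτyy : τx * τy ≤ τy := mul_le_of_le_one_left hy.le hx1
  -- If the cell is fine in both directions, the product of the decay factors works. Otherwise the
  -- decay in a coarse direction suffices alone, and the other factor is bounded by one.
  have key : ∃ τ, 0 < τ ∧ τx * τy ≤ τ ∧ τ ≤ τx + τy ∧
      ((T.hx * ε⁻¹ * (N * τ) ≤ K ∧ T.hy * ε⁻¹ * (N * τ) ≤ K) ∨ τ = (N : ℝ)⁻¹) := by
    have hN := h.N_pos
    have hhx := h.hx_pos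
    have hhy := h.hy_pos
    rcases h.fine_or_coarse_x with h1 | h1
    · rcases h.fine_or_coarse_y with h2 | h2
      · refine ⟨τx * τy, by positivity, le_rfl, by linarith, Or.inl ⟨h1.trans' ?_, h2.trans' ?_⟩⟩ <;>
          gcongr
      · exact ⟨τy, hy, hτyy, by linarith, Or.inr h2⟩
    · exact ⟨τx, hx, hτxx, by linarith, Or.inr h1⟩
  obtain ⟨τ, hτ, hτ1, hτ2, hτ3⟩ := key
  refine jetApproxOn_component hw h.fst.lt h.snd.lt h.subset hC h.one_le (by positivity)
    (sx := ε⁻¹) (sy := ε⁻¹) (τ := τ) (by positivity) (by positivity) hτ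
    (by have := h.N_ge; omega)
    (h.ae_bound_of_weight_le hC
      (W := fun i j z => (ε ^ (i + j))⁻¹ * Real.exp (-((β₁ * z.1 + β₂ * z.2) / ε))) hb
      fun i j z hz => ?_) hτ3 (by gcongr) (by gcongr)
  rw [← pow_add, inv_pow]
  refine mul_le_mul_of_nonneg_left ((hexp z hz).trans ?_) (by positivity)
  gcongr

end MeshCell

theorem exp_neg_le_one {β x ε : ℝ} (hβ : 0 < β) (hx : 0 < x) (hε : 0 < ε) :
    Real.exp (-(β * x / ε)) ≤ 1 := by
  rw [Real.exp_le_one_iff, neg_nonpos]; positivity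

/-- Maximum norm bounds for the projection errors of `u` and of its gradient on a mesh cell. -/
theorem exists_cell_bounds {k : ℕ} (hk : 1 ≤ k) {β₁ β₂ : ℝ} (hβ₁ : 0 < β₁) (hβ₂ : 0 < β₂) (C₀ : ℝ)
    {K : ℝ} (hK : 1 ≤ K) :
    ∃ D : ℝ, 0 < D ∧ ∀ (N i j : ℕ) (ε τx τy : ℝ) (T : Rect) (u : ℝ × ℝ → ℝ),
      MeshCell k β₁ β₂ K ε N i j T τx τy → HasLayerDecomposition k ε β₁ β₂ C₀ u →
        (∀ᵐ z ∂volume.restrict T.toSet, |projErr k T u z| ≤ D * (N : ℝ)⁻¹ ^ (k + 1)) ∧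
        (∀ z ∈ T.toSet, |trace T (projErr k T u) z| ≤ D * (N : ℝ)⁻¹ ^ (k + 1)) ∧
        (∀ z ∈ T.toSet, |trace T (projErr k T (weakDeriv 1 0 u)) z|
          ≤ D * ((N : ℝ)⁻¹ ^ k * (ε⁻¹ * (τx + τy)))) ∧
        ∀ z ∈ T.toSet, |trace T (projErr k T (weakDeriv 0 1 u)) z|
          ≤ D * ((N : ℝ)⁻¹ ^ k * (ε⁻¹ * (τx + τy))) := by
  obtain ⟨Cp, hCp, hproj⟩ := exists_projErr_bounds k
  set A := (2 * K) ^ (k + 1) * |C₀| * K ^ 2 with hA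
  have hA0 : 0 ≤ A := by positivity
  -- Each of the four components contributes `A`; the `1` keeps the constant positive even if `C₀ =
  -- 0`.
  refine ⟨Cp * (4 * A) + 1, by positivity, fun N i j ε τx τy T u hT hu => ?_⟩
  obtain ⟨S, E₁, E₂, E₁₂, hsum, hS, h1, h2, h12⟩ := hu
  have hε := hT.eps_pos
  obtain ⟨wS, eS, jS, bS, cS⟩ := exists_regular_jet hS (M := fun _ _ => 1)
    fun i j z _ => ⟨zero_le_one, le_rfl⟩
  obtain ⟨w1, e1, j1, b1, c1⟩ := exists_regular_jet h1 (M := fun _ j => (ε ^ j)⁻¹)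
    fun i j z hz => ⟨by positivity,
      mul_le_of_le_one_right (by positivity) (exp_neg_le_one hβ₂ hz.2.1 hε)⟩
  obtain ⟨w2, e2, j2, b2, c2⟩ := exists_regular_jet h2 (M := fun i _ => (ε ^ i)⁻¹)
    fun i j z hz => ⟨by positivity,
      mul_le_of_le_one_right (by positivity) (exp_neg_le_one hβ₁ hz.1.1 hε)⟩
  obtain ⟨w12, e12, j12, b12, c12⟩ := exists_regular_jet h12 (M := fun i j => (ε ^ (i + j))⁻¹)
    fun i j z hz => ⟨by positivity, mul_le_of_le_one_right (by positivity) (by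
      have hz1 := hz.1.1
      have hz2 := hz.2.1
      rw [Real.exp_le_one_iff, neg_nonpos]; positivity)⟩
  set w : ℕ → ℕ → ℝ × ℝ → ℝ := wS + w1 + w2 + w12 with hw
  have heu : w 0 0 =ᵐ[volume.restrict unitSquare] u := by
    filter_upwards [hsum, eS, e1, e2, e12] with z hz hzS hz1 hz2 hz12
    rw [hz, hzS, hz1, hz2, hz12]; rfl
  have hder : ∀ p q, p + q ≤ k + 1 → IsWeakDeriv p q u (w p q) := fun p q hpq =>
    IsWeakDeriv.congr_left (((((jS p q hpq).1.add (j1 p q hpq).1).add (j2 p q hpq).1).add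
      (j12 p q hpq).1)) heu
  have hcont : ∀ p q, p + q ≤ k → ∃ g : ℝ × ℝ → ℝ, Continuous g ∧
      w p q =ᵐ[volume.restrict unitSquare] g := by
    intro p q hpq
    obtain ⟨gS, hgS, heS⟩ := cS p q hpq
    obtain ⟨g1, hg1, he1⟩ := c1 p q hpq
    obtain ⟨g2, hg2, he2⟩ := c2 p q hpq
    obtain ⟨g12, hg12, he12⟩ := c12 p q hpq
    exact ⟨gS + g1 + g2 + g12, ((hgS.add hg1).add hg2).add hg12,
      ((heS.add he1).add he2).add he12⟩
  have happ : JetApproxOn k T _ _ w :=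
    (((hT.jetApproxOn_smooth jS (abs_nonneg _) bS).add
      (hT.jetApproxOn_layerY j1 (abs_nonneg _) b1)).add
      (hT.jetApproxOn_layerX j2 (abs_nonneg _) b2)).add
      (hT.jetApproxOn_corner j12 (abs_nonneg _) b12)
  rw [← hA] at happ
  have hτx := hT.τx_pos
  have hτy := hT.τy_pos
  -- Stated for any `v` in the almost everywhere class, to cover `u` itself and the representatives
  -- chosen by `weakDeriv`.
  have hder0 : ∀ p q, p + q ≤ k → ∀ v : ℝ × ℝ → ℝ, w p q =ᵐ[volume.restrict unitSquare] v →
      ∀ B, 0 ≤ B → ApproxOn k T (A * B + A * B + A * B + A * B) (w p q) →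
      (∀ᵐ z ∂volume.restrict T.toSet, |projErr k T v z| ≤ (Cp * (4 * A) + 1) * B) ∧
      ∀ z ∈ T.toSet, |trace T (projErr k T v) z| ≤ (Cp * (4 * A) + 1) * B := by
    intro p q hpq v hv B hB hap
    obtain ⟨g, hg, hge⟩ := hcont p q hpq
    obtain ⟨h1, h2⟩ := hproj T hT.fst.lt hT.snd.lt v g _ hg (hT.ae_restrict (hv.symm.trans hge))
      (hap.congr (hT.ae_restrict hv))
    have hle : Cp * (A * B + A * B + A * B + A * B) ≤ (Cp * (4 * A) + 1) * B := by
      linarith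
    exact ⟨h1.mono fun z hz => hz.trans hle, fun z hz => (h2 z hz).trans hle⟩
  have r0 := hder0 0 0 (by omega) u heu _ (by positivity) happ.1
  refine ⟨r0.1, r0.2, ?_, ?_⟩
  · exact (hder0 1 0 (by omega) _ (weakDeriv_ae_eq (hder 1 0 (by omega))).symm _ (by positivity)
      happ.2.1).2
  · exact (hder0 0 1 (by omega) _ (weakDeriv_ae_eq (hder 0 1 (by omega))).symm _ (by positivity)
      happ.2.2).2

/-! ### Summation over the mesh -/

/-- Crude counting of the `N ^ 2` cells; the cell bounds are uniform, so no finer summation is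
needed. -/
theorem meshNorm_le {N : ℕ} {a : ℕ → ℕ → ℝ≥0∞} {G X : ℝ} (hX : 0 ≤ X)
    (h : ∀ i < N, ∀ j < N, a i j ≤ ENNReal.ofReal G) (hG : (N : ℝ) ^ 2 * G ≤ X ^ 2) :
    meshNorm N a ≤ ENNReal.ofReal X := by
  have h1 : ∑ i ∈ Finset.range N, ∑ j ∈ Finset.range N, a i j ≤ ENNReal.ofReal (X ^ 2) := by
    calc _ ≤ ∑ _i ∈ Finset.range N, ∑ _j ∈ Finset.range N, ENNReal.ofReal G :=
          Finset.sum_le_sum fun i hi => Finset.sum_le_sum fun j hj =>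
            h i (Finset.mem_range.1 hi) j (Finset.mem_range.1 hj)
      _ = ENNReal.ofReal ((N : ℝ) ^ 2 * G) := by
          simp only [Finset.sum_const, Finset.card_range, nsmul_eq_mul]
          rw [ENNReal.ofReal_mul (by positivity), ENNReal.ofReal_pow (by positivity),
            ENNReal.ofReal_natCast, sq, mul_assoc]
      _ ≤ _ := ENNReal.ofReal_le_ofReal hG
  rw [meshNorm]
  refine (ENNReal.rpow_le_rpow h1 (by norm_num)).trans_eq ?_
  rw [ENNReal.ofReal_rpow_of_nonneg (sq_nonneg X) (by norm_num), ← Real.sqrt_eq_rpow,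
    Real.sqrt_sq hX]

theorem add_le_ofReal {a b : ℝ≥0∞} {X Y : ℝ} (hX : 0 ≤ X) (ha : a ≤ ENNReal.ofReal X)
    (hb : b ≤ ENNReal.ofReal X) (h : 2 * X ≤ Y) : a + b ≤ ENNReal.ofReal Y := by
  refine (add_le_add ha hb).trans ?_
  rw [← ENNReal.ofReal_add hX hX]
  exact ENNReal.ofReal_le_ofReal (by linarith)

namespace MeshCell

variable {k N i j : ℕ} {β₁ β₂ K ε τx τy : ℝ} {T : Rect}

theorem hx_le (h : MeshCell k β₁ β₂ K ε N i j T τx τy) : T.hx ≤ K * (N : ℝ)⁻¹ := by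
  rw [← div_eq_mul_inv, le_div_iff₀ h.N_pos]; exact h.fst.width_le

theorem hy_le (h : MeshCell k β₁ β₂ K ε N i j T τx τy) : T.hy ≤ K * (N : ℝ)⁻¹ := by
  rw [← div_eq_mul_inv, le_div_iff₀ h.N_pos]; exact h.snd.width_le

/-- Outside of `Ω₀` the cells are thin where the layer functions are large. -/
theorem area_mul_sq_le (h : MeshCell k β₁ β₂ K ε N i j T τx τy) (hΩ : ¬ InOmega0 N i j) :
    T.hx * T.hy * (τx + τy) ^ 2 ≤ 4 * K ^ 2 * ε * (N : ℝ)⁻¹ ^ 2 := by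
  have hN := h.N_pos
  have hx := h.hx_pos
  have hy := h.hy_pos
  have hτx := h.τx_pos
  have hτy := h.τy_pos
  have hε := h.eps_pos
  have hK : 0 < K := by linarith [h.one_le]
  -- One factor `τ` is absorbed by the fine width `a`, the other is at most one, and `b` gives a
  -- further `N⁻¹`.
  have key : ∀ {a b τ : ℝ}, 0 < a → 0 < b → 0 < τ → τ ≤ 1 → a * (N * τ) ≤ K * ε →
      b ≤ K * (N : ℝ)⁻¹ → a * b * τ ^ 2 ≤ K ^ 2 * ε * (N : ℝ)⁻¹ ^ 2 := by
    intro a b τ ha hb hτ hτ1 h1 h2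
    calc a * b * τ ^ 2 = (a * (N * τ)) * b * τ * (N : ℝ)⁻¹ := by field_simp
      _ ≤ (K * ε) * (K * (N : ℝ)⁻¹) * 1 * (N : ℝ)⁻¹ := by gcongr
      _ = _ := by ring
  have hfx : i + 1 < N / 2 → T.hx * T.hy * τx ^ 2 ≤ K ^ 2 * ε * (N : ℝ)⁻¹ ^ 2 := fun hi =>
    key hx hy hτx h.fst.tau_le (h.fst.fine hi) h.hy_le
  have hfy : j + 1 < N / 2 → T.hx * T.hy * τy ^ 2 ≤ K ^ 2 * ε * (N : ℝ)⁻¹ ^ 2 := fun hj => by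
    rw [mul_comm T.hx]
    exact key hy hx hτy h.snd.tau_le (h.snd.fine hj) h.hx_le
  have hboth : T.hx * T.hy * τx ^ 2 ≤ K ^ 2 * ε * (N : ℝ)⁻¹ ^ 2 ∧
      T.hx * T.hy * τy ^ 2 ≤ K ^ 2 * ε * (N : ℝ)⁻¹ ^ 2 := by
    -- In a mixed cell the coarse direction has the least possible value `N⁻¹`, so the fine
    -- direction dominates.
    rcases lt_or_ge (i + 1) (N / 2) with hi | hi <;> rcases lt_or_ge (j + 1) (N / 2) with hj | hj
    · exact ⟨hfx hi, hfy hj⟩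
    · refine ⟨hfx hi, (hfx hi).trans' ?_⟩
      have : τy ≤ τx := (h.snd.coarse hj).trans_le h.fst.inv_le
      gcongr
    · refine ⟨(hfy hj).trans' ?_, hfy hj⟩
      have : τx ≤ τy := (h.fst.coarse hi).trans_le h.snd.inv_le
      gcongr
    · exact absurd ⟨hi, hj⟩ hΩ
  have hp : 0 < T.hx * T.hy := by positivity
  nlinarith [mul_nonneg hp.le (sq_nonneg (τx - τy)), hboth.1, hboth.2]

/-- The weighted size of the gradient error on a cell; `h₁` is the length of the edge. -/
theorem theta_mul_le (hT : MeshCell k β₁ β₂ K ε N i j T τx τy) {D h₁ h₂ : ℝ}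
    (h₁0 : 0 ≤ h₁) (h₁K : h₁ ≤ K * (N : ℝ)⁻¹) (h12 : h₂ * h₁ = T.hx * T.hy) :
    theta ε N i j h₂ * (4 * h₁ * (D * ((N : ℝ)⁻¹ ^ k * (ε⁻¹ * (τx + τy)))) ^ 2)
      ≤ 16 * K ^ 2 * D ^ 2 * (N : ℝ)⁻¹ ^ (2 * k + 2) := by
  have hN := hT.N_pos
  have hε := hT.eps_pos
  have hK := hT.one_le
  have hν : (N : ℝ)⁻¹ ≤ 1 := by
    apply inv_le_one_of_one_le₀
    have := hT.N_ge
    exact_mod_cast (by omega : 1 ≤ N)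
  set ν := (N : ℝ)⁻¹ with hνdef
  have hν0 : 0 < ν := inv_pos.2 hN
  rw [theta]
  split_ifs with hΩ
  -- In `Ω₀` both decay factors are `N⁻¹` and the weight cancels `ε⁻²` exactly.
  · rw [hT.fst.coarse hΩ.1, hT.snd.coarse hΩ.2, ← hνdef]
    calc ε ^ 2 * ν * (4 * h₁ * (D * (ν ^ k * (ε⁻¹ * (ν + ν)))) ^ 2)
        = 16 * h₁ * D ^ 2 * ν ^ (2 * k + 2) * ν := by field_simp; ring
      _ ≤ 16 * (K * ν) * D ^ 2 * ν ^ (2 * k + 2) * ν := by gcongr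
      _ = 16 * K * D ^ 2 * ν ^ (2 * k + 2) * (ν * ν) := by ring
      _ ≤ 16 * K ^ 2 * D ^ 2 * ν ^ (2 * k + 2) * 1 := by
          have : K ≤ K ^ 2 := hT.le_sq
          gcongr
          nlinarith
      _ = _ := mul_one _
  · have h := hT.area_mul_sq_le hΩ
    rw [← hνdef] at h
    calc ε * h₂ * (4 * h₁ * (D * (ν ^ k * (ε⁻¹ * (τx + τy)))) ^ 2)
        = 4 * D ^ 2 * ν ^ (2 * k) * ε⁻¹ * ((h₂ * h₁) * (τx + τy) ^ 2) := by field_simp; ring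
      _ = 4 * D ^ 2 * ν ^ (2 * k) * ε⁻¹ * (T.hx * T.hy * (τx + τy) ^ 2) := by rw [h12]
      _ ≤ 4 * D ^ 2 * ν ^ (2 * k) * ε⁻¹ * (4 * K ^ 2 * ε * ν ^ 2) := by gcongr
      _ = _ := by field_simp; ring

/-- The weighted size of the error on a cell; `h₁` is the length of the edge. -/
theorem vartheta_mul_le (hT : MeshCell k β₁ β₂ K ε N i j T τx τy) {D h₁ h₂ : ℝ}
    (h₁0 : 0 ≤ h₁) (h₁K : h₁ ≤ K * (N : ℝ)⁻¹) (h₂0 : 0 < h₂) (h₂K : ε ≤ K * N * h₂) :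
    vartheta ε N i j h₂ * (2 * h₁ * (D * (N : ℝ)⁻¹ ^ (k + 1)) ^ 2)
      ≤ 2 * K ^ 2 * D ^ 2 * (N : ℝ)⁻¹ ^ (2 * k + 2) := by
  have hN := hT.N_pos
  have hε := hT.eps_pos
  have hK := hT.one_le
  -- Outside `Ω₀` this is the lower bound on the mesh width, so no `ε` survives in the weight.
  have hv : vartheta ε N i j h₂ ≤ K * N := by
    rw [vartheta]
    split_ifs
    · exact le_mul_of_one_le_left hN.le hK
    · rwa [← div_eq_mul_inv, div_le_iff₀ h₂0]
  have hv0 : 0 ≤ vartheta ε N i j h₂ := by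
    rw [vartheta]; split_ifs <;> positivity
  calc _ ≤ K * N * (2 * (K * (N : ℝ)⁻¹) * (D * (N : ℝ)⁻¹ ^ (k + 1)) ^ 2) := by gcongr
    _ = 2 * K ^ 2 * D ^ 2 * (N : ℝ)⁻¹ ^ (2 * k + 2) * (N * (N : ℝ)⁻¹) := by ring
    _ = _ := by rw [mul_inv_cancel₀ hN.ne', mul_one]

end MeshCell

theorem ofReal_mul_le_of_le {a X Y : ℝ} {e : ℝ≥0∞} (ha : 0 ≤ a) (he : e ≤ ENNReal.ofReal X)
    (h : a * X ≤ Y) : ENNReal.ofReal a * e ≤ ENNReal.ofReal Y :=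
  calc ENNReal.ofReal a * e ≤ ENNReal.ofReal a * ENNReal.ofReal X := by gcongr
    _ = ENNReal.ofReal (a * X) := (ENNReal.ofReal_mul ha).symm
    _ ≤ _ := ENNReal.ofReal_le_ofReal h

theorem theta_nonneg {ε h : ℝ} (hε : 0 ≤ ε) (hh : 0 ≤ h) (N i j : ℕ) : 0 ≤ theta ε N i j h := by
  rw [theta]; split_ifs <;> positivity

theorem vartheta_nonneg {ε h : ℝ} (hε : 0 ≤ ε) (hh : 0 ≤ h) (N i j : ℕ) :
    0 ≤ vartheta ε N i j h := by
  rw [vartheta]; split_ifs <;> positivity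

end LayerMesh

open LayerMesh
-- Assembly of the four global estimates
theorem mainTheorem2 (k : ℕ) (hk : 1 ≤ k) (σ β₁ β₂ C₀ : ℝ) (hσ : (k : ℝ) + 1 ≤ σ)
    (hβ₁ : 0 < β₁) (hβ₂ : 0 < β₂) :
    ∃ C : ℝ, 0 < C ∧
      ∀ (N : ℕ) (ε : ℝ) (u : ℝ × ℝ → ℝ), 4 ≤ N → Even N → 0 < ε → ε ≤ (N : ℝ)⁻¹ →
        meshPoint σ ε β₁ N (N / 2) ≤ 1 / 2 → meshPoint σ ε β₂ N (N / 2) ≤ 1 / 2 →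
        MemH (k + 1) u → HasLayerDecomposition k ε β₁ β₂ C₀ u →
        let T : ℕ → ℕ → Rect := meshElem σ ε β₁ β₂ N
        let ux : ℝ × ℝ → ℝ := weakDeriv 1 0 u
        let uy : ℝ × ℝ → ℝ := weakDeriv 0 1 u
        meshNorm N (fun i j => normSq (T i j) (projErr k (T i j) u))
            ≤ ENNReal.ofReal (C * (N : ℝ) ^ (-((k : ℝ) + 1))) ∧
        meshNorm N (fun i j => edgeNormSqX (T i j) (projErr k (T i j) u))
              + meshNorm N (fun i j => edgeNormSqY (T i j) (projErr k (T i j) u))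
            ≤ ENNReal.ofReal (C * (N : ℝ) ^ (-((k : ℝ) + 1 / 2))) ∧
        meshNorm N (fun i j => ENNReal.ofReal (theta ε N i j (T i j).hy) *
                (edgeNormSqX (T i j) (projErr k (T i j) ux)
                  + edgeNormSqX (T i j) (projErr k (T i j) uy)))
              + meshNorm N (fun i j => ENNReal.ofReal (theta ε N i j (T i j).hx) *
                (edgeNormSqY (T i j) (projErr k (T i j) ux)
                  + edgeNormSqY (T i j) (projErr k (T i j) uy)))
            ≤ ENNReal.ofReal (C * (N : ℝ) ^ (-(k : ℝ))) ∧
        meshNorm N (fun i j => ENNReal.ofReal (vartheta ε N i j (T i j).hy) *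
                edgeNormSqX (T i j) (projErr k (T i j) u))
              + meshNorm N (fun i j => ENNReal.ofReal (vartheta ε N i j (T i j).hx) *
                edgeNormSqY (T i j) (projErr k (T i j) u))
            ≤ ENNReal.ofReal (C * (N : ℝ) ^ (-(k : ℝ))) := by
  obtain ⟨K₁, hK₁, hmesh₁⟩ := exists_meshInterval k hσ hβ₁
  obtain ⟨K₂, hK₂, hmesh₂⟩ := exists_meshInterval k hσ hβ₂
  set K := max K₁ K₂
  have hK : 1 ≤ K := hK₁.trans (le_max_left _ _)
  obtain ⟨D, hD, hcell⟩ := exists_cell_bounds hk hβ₁ hβ₂ C₀ hK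
  have hKD : 0 < K * D := by positivity
  -- The gradient estimate determines the `8`: each of the two edge directions contributes `4 * (K *
  -- D)`.
  refine ⟨8 * (K * D), by positivity, ?_⟩
  intro N ε u hN4 hNe hε hεN hh₁ hh₂ _ hu T ux uy
  have hN : (0 : ℝ) < N := by exact_mod_cast (by omega : 0 < N)
  have hT : ∀ i < N, ∀ j < N, ∃ τx τy, MeshCell k β₁ β₂ K ε N i j (T i j) τx τy := by
    intro i hi j hj
    obtain ⟨τx, hx⟩ := hmesh₁ N ε hN4 hNe hε hεN hh₁ i hi
    obtain ⟨τy, hy⟩ := hmesh₂ N ε hN4 hNe hε hεN hh₂ j hj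
    exact ⟨τx, τy, hK, hε, hεN, hN4, hx.mono (le_max_left _ _) hε.le,
      hy.mono (le_max_right _ _) hε.le⟩
  have p1 : (N : ℝ) ^ (-((k : ℝ) + 1)) = (N : ℝ)⁻¹ ^ (k + 1) := by
    rw [Real.rpow_neg hN.le, inv_pow, ← Real.rpow_natCast]; push_cast; rfl
  have p2 : (N : ℝ) ^ (-(k : ℝ)) = (N : ℝ)⁻¹ ^ k := by
    rw [Real.rpow_neg hN.le, inv_pow, Real.rpow_natCast]
  -- The half-integer power becomes a natural power after squaring, which is the form `meshNorm_le`
  -- asks for.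
  have p3 : ((N : ℝ) ^ (-((k : ℝ) + 1 / 2))) ^ 2 = (N : ℝ)⁻¹ ^ (2 * k + 1) := by
    rw [← Real.rpow_natCast, ← Real.rpow_mul hN.le, inv_pow, ← Real.rpow_natCast,
      ← Real.rpow_neg hN.le]
    congr 1; push_cast; ring
  have p3' : 0 < (N : ℝ) ^ (-((k : ℝ) + 1 / 2)) := Real.rpow_pos_of_pos hN _
  rw [p1, p2]
  set ν := (N : ℝ)⁻¹ with hν
  set ρ := (N : ℝ) ^ (-((k : ℝ) + 1 / 2))
  have hν0 : 0 < ν := inv_pos.2 hN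
  have hNν : (N : ℝ) * ν = 1 := mul_inv_cancel₀ hN.ne'
  have sum2 : ∀ c : ℝ, (N : ℝ) ^ 2 * (c * ν ^ (2 * k + 2)) = c * ν ^ (2 * k) := fun c =>
    calc _ = c * ν ^ (2 * k) * ((N : ℝ) * ν) ^ 2 := by ring
      _ = _ := by rw [hNν]; ring
  have sum1 : ∀ c : ℝ, (N : ℝ) ^ 2 * (c * ν * (ν ^ (k + 1)) ^ 2) = c * ν ^ (2 * k + 1) := fun c =>
    calc _ = c * ν ^ (2 * k + 1) * ((N : ℝ) * ν) ^ 2 := by ring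
      _ = _ := by rw [hNν]; ring
  refine ⟨?_, ?_, ?_, ?_⟩
  · refine meshNorm_le (G := K ^ 2 * D ^ 2 * ν ^ 2 * ν ^ (2 * k + 2)) (by positivity)
      (fun i hi j hj => ?_) ?_
    · obtain ⟨τx, τy, h⟩ := hT i hi j hj
      refine (normSq_le h.fst.lt h.snd.lt (hcell N i j ε τx τy _ u h hu).1).trans
        (ENNReal.ofReal_le_ofReal ?_)
      have hx := h.hx_le
      have hy := h.hy_le
      have hx0 := h.hx_pos
      have hy0 := h.hy_pos
      calc _ ≤ (K * ν) * (K * ν) * (D * ν ^ (k + 1)) ^ 2 := by gcongr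
        _ = _ := by ring
    · rw [sum2]
      calc K ^ 2 * D ^ 2 * ν ^ 2 * ν ^ (2 * k) = 1 * (K * D * ν ^ (k + 1)) ^ 2 := by ring
        _ ≤ 64 * (K * D * ν ^ (k + 1)) ^ 2 := by gcongr; norm_num
        _ = _ := by ring
  · have hfin : (N : ℝ) ^ 2 * (2 * K * D ^ 2 * ν * (ν ^ (k + 1)) ^ 2) ≤ (2 * (K * D) * ρ) ^ 2 := by
      rw [sum1, mul_pow, p3]
      refine mul_le_mul_of_nonneg_right ?_ (by positivity)
      have : K ≤ K ^ 2 := by nlinarith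
      calc 2 * K * D ^ 2 ≤ 4 * K ^ 2 * D ^ 2 := by gcongr; norm_num
        _ = _ := by ring
    refine add_le_ofReal (X := 2 * (K * D) * ρ) (by positivity)
      (meshNorm_le (by positivity) (fun i hi j hj => ?_) hfin)
      (meshNorm_le (by positivity) (fun i hi j hj => ?_) hfin) (by nlinarith)
    · obtain ⟨τx, τy, h⟩ := hT i hi j hj
      refine (edgeNormSqX_le h.fst.lt h.snd.lt (hcell N i j ε τx τy _ u h hu).2.1).trans
        (ENNReal.ofReal_le_ofReal ?_)
      have hx := h.hx_le
      calc _ ≤ 2 * (K * ν) * (D * ν ^ (k + 1)) ^ 2 := by gcongr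
        _ = _ := by ring
    · obtain ⟨τx, τy, h⟩ := hT i hi j hj
      refine (edgeNormSqY_le h.fst.lt h.snd.lt (hcell N i j ε τx τy _ u h hu).2.1).trans
        (ENNReal.ofReal_le_ofReal ?_)
      have hy := h.hy_le
      calc _ ≤ 2 * (K * ν) * (D * ν ^ (k + 1)) ^ 2 := by gcongr
        _ = _ := by ring
  · have hfin : (N : ℝ) ^ 2 * (16 * K ^ 2 * D ^ 2 * ν ^ (2 * k + 2)) ≤ (4 * (K * D) * ν ^ k) ^ 2 := by
      rw [sum2]; apply le_of_eq; ring
    -- The two components of the gradient obey the same bound on each edge.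
    have hadd : ∀ {a b : ℝ≥0∞} {h B : ℝ}, 0 ≤ h → a ≤ ENNReal.ofReal (2 * h * B ^ 2) →
        b ≤ ENNReal.ofReal (2 * h * B ^ 2) → a + b ≤ ENNReal.ofReal (4 * h * B ^ 2) :=
      fun hh ha hb => add_le_ofReal (by positivity) ha hb (le_of_eq (by ring))
    refine add_le_ofReal (X := 4 * (K * D) * ν ^ k) (by positivity)
      (meshNorm_le (by positivity) (fun i hi j hj => ?_) hfin)
      (meshNorm_le (by positivity) (fun i hi j hj => ?_) hfin) (le_of_eq (by ring))
    · obtain ⟨τx, τy, h⟩ := hT i hi j hj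
      obtain ⟨-, -, hbx, hby⟩ := hcell N i j ε τx τy _ u h hu
      exact ofReal_mul_le_of_le (theta_nonneg hε.le h.hy_pos.le N i j)
        (hadd h.hx_pos.le (edgeNormSqX_le h.fst.lt h.snd.lt hbx)
          (edgeNormSqX_le h.fst.lt h.snd.lt hby))
        (h.theta_mul_le h.hx_pos.le h.hx_le (mul_comm _ _))
    · obtain ⟨τx, τy, h⟩ := hT i hi j hj
      obtain ⟨-, -, hbx, hby⟩ := hcell N i j ε τx τy _ u h hu
      exact ofReal_mul_le_of_le (theta_nonneg hε.le h.hx_pos.le N i j)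
        (hadd h.hy_pos.le (edgeNormSqY_le h.fst.lt h.snd.lt hbx)
          (edgeNormSqY_le h.fst.lt h.snd.lt hby))
        (h.theta_mul_le h.hy_pos.le h.hy_le rfl)
  · have hfin : (N : ℝ) ^ 2 * (2 * K ^ 2 * D ^ 2 * ν ^ (2 * k + 2)) ≤ (2 * (K * D) * ν ^ k) ^ 2 := by
      rw [sum2]
      calc 2 * K ^ 2 * D ^ 2 * ν ^ (2 * k) ≤ 4 * K ^ 2 * D ^ 2 * ν ^ (2 * k) := by gcongr; norm_num
        _ = _ := by ring
    have hpos : 0 < K * D * ν ^ k := by positivity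
    refine add_le_ofReal (X := 2 * (K * D) * ν ^ k) (by positivity)
      (meshNorm_le (by positivity) (fun i hi j hj => ?_) hfin)
      (meshNorm_le (by positivity) (fun i hi j hj => ?_) hfin) (by linarith)
    · obtain ⟨τx, τy, h⟩ := hT i hi j hj
      exact ofReal_mul_le_of_le (vartheta_nonneg hε.le h.hy_pos.le N i j)
        (edgeNormSqX_le h.fst.lt h.snd.lt (hcell N i j ε τx τy _ u h hu).2.1)
        (h.vartheta_mul_le h.hx_pos.le h.hx_le h.hy_pos h.snd.le_width)
    · obtain ⟨τx, τy, h⟩ := hT i hi j hj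
      exact ofReal_mul_le_of_le (vartheta_nonneg hε.le h.hx_pos.le N i j)
        (edgeNormSqY_le h.fst.lt h.snd.lt (hcell N i j ε τx τy _ u h hu).2.1)
        (h.vartheta_mul_le h.hy_pos.le h.hy_le h.hx_pos h.fst.le_width)
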